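/- Let $H\in(0,1)$ and let $B^H=(B^H_t)_{t\in\mathbb R}$ be a fractional Brownian motion with Hurst index $H$ on a probability space, i.e. a centered Gaussian process with $E B^H_tB^H_s=\frac12(|t|^{2H}+|s|^{2H}-|t-s|^{2H})$ whose paths are almost surely locally Hölder continuous of every order strictly smaller than $H$. For $\gamma\in\mathbb R$ and $t\ge 0$ let $$B^H_{\gamma,t}=\int_0^t e^{-\gamma(t-s)}\,dB^H_s$$ be the fractional Ornstein–Uhlenbeck process (a pathwise Riemann–Stieltjes integral), and put $$J_H(\gamma)=\int_0^1 (B^H_{\gamma,s})^2\,ds,\qquad N_H(\gamma)=\tfrac12 (B^H_{\gamma,1})^2+\gamma J_H(\gamma),$$ $$\tau_H(\gamma)=\bigl(J_H(\gamma)^{-1/2},\;J_H(\gamma)^{-1},\;N_H(\gamma)J_H(\gamma)^{-1/2},\;N_H(\gamma)J_H(\gamma)^{-1}\bigr)'\in\mathbb R^4 .$$ Almost surely, for all $\gamma\in\mathbb R$, these Riemann–Stieltjes integrals exist for all $t\ge0$ and $J_H(\gamma)>0$, so that $\tau_H(\gamma)$ is well defined. As $\gamma\to-\infty$, $$\mathrm{diag}\bigl(|\gamma|^{-(2H+1)/2}e^{|\gamma|},\,|\gamma|^{-2H-1}e^{2|\gamma|},\,|\gamma|^{(2H-1)/2},\,|\gamma|^{-1}e^{|\gamma|}\bigr)\,\tau_H(\gamma)$$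 converges in distribution to $$\mathrm{diag}\Bigl(\frac{2}{\Gamma(2H+1)^{1/2}},\,\frac{4}{\Gamma(2H+1)},\,\Gamma(2H+1)^{1/2},\,2\Bigr)\,\bigl(|Z|^{-1},\,Z^{-2},\,Y\,\mathrm{sign}(Z),\,Y/Z\bigr)',$$ where $(Y,Z)$ is a standard normal vector in $\mathbb R^2$, $\mathrm{sign}(x)=1$ for $x\ge0$ and $\mathrm{sign}(x)=-1$ for $x<0$. Moreover $Y/Z$ has the standard Cauchy distribution. -/

import Mathlib

open MeasureTheory ProbabilityTheory Filter Topology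

/-- `B = (B_t)_{t ∈ ℝ}` is a fractional Brownian motion with Hurst index `H` under `P`: a centered
Gaussian process with covariance `(|t|^{2H} + |s|^{2H} - |t - s|^{2H}) / 2` whose paths are almost
surely locally Hölder continuous of every order strictly smaller than `H`. -/
structure IsFractionalBrownianMotion {Ω : Type*} [MeasurableSpace Ω] (H : ℝ) (B : ℝ → Ω → ℝ)
    (P : Measure Ω) : Prop where
  isGaussianProcess : IsGaussianProcess B P
  centered : ∀ t : ℝ, ∫ ω, B t ω ∂P = 0
  covariance : ∀ s t : ℝ, ∫ ω, B t ω * B s ω ∂P =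
    (1 / 2) * (|t| ^ (2 * H) + |s| ^ (2 * H) - |t - s| ^ (2 * H))
  locallyHolder : ∀ᵐ ω ∂P, ∀ α : NNReal, 0 < α → (α : ℝ) < H → ∀ T : ℝ,
    ∃ C : NNReal, HolderOnWith C α (fun t => B t ω) (Set.Icc (-T) T)

/-- The Riemann–Stieltjes integral `∫_a^b f dg` (for `a ≤ b`) exists and equals `I`: the sums
`∑ f(ξ_i) (g(u_{i+1}) - g(u_i))` over the tagged partitions
`a = u_0 ≤ ξ_0 ≤ u_1 ≤ ξ_1 ≤ ⋯ ≤ u_n = b` tend to `I` as the mesh tends to zero. -/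
def HasRSIntegral (f g : ℝ → ℝ) (a b I : ℝ) : Prop :=
  ∀ ε > 0, ∃ δ > 0, ∀ (n : ℕ) (u ξ : ℕ → ℝ), u 0 = a → u n = b →
    (∀ i < n, u i ≤ ξ i ∧ ξ i ≤ u (i + 1) ∧ u (i + 1) - u i < δ) →
      |∑ i ∈ Finset.range n, f (ξ i) * (g (u (i + 1)) - g (u i)) - I| < ε

/-- The Riemann–Stieltjes integral `∫_a^b f dg` exists. -/
def RSIntegrable (f g : ℝ → ℝ) (a b : ℝ) : Prop := ∃ I : ℝ, HasRSIntegral f g a b I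

open Classical in
/-- The Riemann–Stieltjes integral `∫_a^b f dg` (and `0` if it does not exist). -/
noncomputable def rsIntegral (f g : ℝ → ℝ) (a b : ℝ) : ℝ :=
  if h : RSIntegrable f g a b then h.choose else 0

/-- There is at most one value of the integral, so `rsIntegral` does not depend on a choice. -/
theorem HasRSIntegral.unique {f g : ℝ → ℝ} {a b I J : ℝ} (hab : a ≤ b)
    (hI : HasRSIntegral f g a b I) (hJ : HasRSIntegral f g a b J) : I = J := by
  by_contra hne
  have hpos : 0 < |I - J| / 2 := half_pos (abs_pos.2 (sub_ne_zero.2 hne))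
  obtain ⟨δ₁, h1, H1⟩ := hI _ hpos
  obtain ⟨δ₂, h2, H2⟩ := hJ _ hpos
  obtain ⟨n, hn⟩ := exists_nat_gt ((b - a) / min δ₁ δ₂)
  have hm : 0 < min δ₁ δ₂ := lt_min h1 h2
  have hn0 : (0 : ℝ) < n := lt_of_le_of_lt (div_nonneg (sub_nonneg.2 hab) hm.le) hn
  have hstep : (b - a) / n < min δ₁ δ₂ := by
    rw [div_lt_iff₀ hm] at hn
    rw [div_lt_iff₀ hn0]
    linarith
  have hs0 : 0 ≤ (b - a) / n := div_nonneg (sub_nonneg.2 hab) hn0.le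
  set u : ℕ → ℝ := fun i => a + i * ((b - a) / n) with hu
  have hu0 : u 0 = a := by simp [hu]
  have hun : u n = b := by simp only [hu]; field_simp; ring
  have hd : ∀ i, u (i + 1) - u i = (b - a) / n := by
    intro i; simp only [hu]; push_cast; ring
  have k1 := H1 n u u hu0 hun fun i _ => ⟨le_rfl, by linarith [hd i], by
    rw [hd i]; exact hstep.trans_le (min_le_left _ _)⟩
  have k2 := H2 n u u hu0 hun fun i _ => ⟨le_rfl, by linarith [hd i], by
    rw [hd i]; exact hstep.trans_le (min_le_right _ _)⟩
  rw [abs_lt] at k1 k2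
  rcases abs_cases (I - J) with h | h <;> linarith [k1.1, k1.2, k2.1, k2.2]

/-- The fractional Ornstein–Uhlenbeck transform of a path `b`:
`t ↦ ∫_0^t e^{-γ (t - s)} db_s`, a pathwise Riemann–Stieltjes integral. -/
noncomputable def fOU (γ : ℝ) (b : ℝ → ℝ) (t : ℝ) : ℝ :=
  rsIntegral (fun s => Real.exp (-γ * (t - s))) b 0 t

/-- `∫_0^1 (B_{γ,s})² ds` along the path `b`. -/
noncomputable def fOUEnergy (γ : ℝ) (b : ℝ → ℝ) : ℝ :=
  ∫ s in (0 : ℝ)..1, (fOU γ b s) ^ 2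

/-- The vector `Θ(γ)`, with entries the powers `-1/2` and `-1` of `∫_0^1 (B_{γ,s})² ds`. -/
noncomputable def Theta (γ : ℝ) (b : ℝ → ℝ) : Fin 2 → ℝ :=
  ![(fOUEnergy γ b) ^ (-(1 / 2) : ℝ), (fOUEnergy γ b)⁻¹]

/-- The vector `τ(γ) = (Θ(γ)', ((B_{γ,1})² / 2 + γ ∫_0^1 (B_{γ,s})² ds) Θ(γ)')'`. -/
noncomputable def tau (γ : ℝ) (b : ℝ → ℝ) : Fin 4 → ℝ :=
  ![Theta γ b 0, Theta γ b 1,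
    ((fOU γ b 1) ^ 2 / 2 + γ * fOUEnergy γ b) * Theta γ b 0,
    ((fOU γ b 1) ^ 2 / 2 + γ * fOUEnergy γ b) * Theta γ b 1]

/-- The sign with the convention `sgn 0 = 1`. -/
noncomputable def sgn (x : ℝ) : ℝ := if 0 ≤ x then 1 else -1

/-- The scaling matrix for `γ → -∞`. -/
noncomputable def explosiveScaling (H γ : ℝ) : Matrix (Fin 4) (Fin 4) ℝ :=
  Matrix.diagonal
    ![|γ| ^ (-(2 * H + 1) / 2) * Real.exp |γ|,
      |γ| ^ (-2 * H - 1) * Real.exp (2 * |γ|),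
      |γ| ^ ((2 * H - 1) / 2),
      |γ|⁻¹ * Real.exp |γ|]

/-- The diagonal matrix of constants in the limit. -/
noncomputable def explosiveConstants (H : ℝ) : Matrix (Fin 4) (Fin 4) ℝ :=
  Matrix.diagonal
    ![2 / √(Real.Gamma (2 * H + 1)), 4 / Real.Gamma (2 * H + 1), √(Real.Gamma (2 * H + 1)), 2]

/-! ### Integration by parts for the Riemann–Stieltjes integral, and positivity of the energy. -/

section Pathwise

/-! Put `l = -γ`, and let `b` be a continuous path with `b 0 = 0`. Integration by parts turns the
Riemann–Stieltjes integral into `b t + e^{l t} V(t)` with `V(t) = ∫_0^t l e^{-l s} b_s ds`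
(`laplaceAt`). As `l → ∞` the process is dominated by the explosive term `e^{l t} V(1)`. Up to
exponentially small errors, `2 l e^{-2 l} J` is `V(1)^2` (`abs_exp_mul_fOUEnergy_sub_le`). In `N`
the leading terms of order `e^{2 l}` cancel, and `e^{-l} N` is close to `V(1) W`, where `W` is the
same kind of Laplace functional of the path seen backwards from time 1 (`endpointLaplace`,
`abs_exp_mul_numerator_sub_le`). Everything up to here is deterministic.

The randomness is thus reduced to the pair `(l^H V(1), l^H W)`, a linear functional of a Gaussian
process. Its characteristic function is computed by Riemann sums (`integral_exp_intervalIntegral`).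
By self-similarity and stationary increments both components have the same variance, an explicit
double integral tending to `Γ(2H+1)/2` (`tendsto_integral_integral_fbmCov`). `V(1)` depends
essentially on the path near 0 and `W` on the path near 1; the covariance of increments at the two
ends is quadratic in their lengths, so the rescaled covariance is `O(l^{2H-2})` and vanishes because
`H < 1` (`tendsto_integral_integral_fbmCrossCov`). The limit is therefore a pair of independent
centered normals.

Finally the scaled `τ` is a fixed function (`explosiveMap`) of the scaled energy and numerator,
continuous where the energy coordinate is positive. The limit `Z^2` is almost surely positive, so
the continuous mapping theorem applies. -/

theorem hasRSIntegral_of_hasDerivAt {f f' g : ℝ → ℝ} {a b : ℝ} (hab : a ≤ b)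
    (hf : ∀ x, HasDerivAt f (f' x) x) (hf' : Continuous f') (hg : Continuous g) :
    HasRSIntegral f g a b (f b * g b - f a * g a - ∫ s in a..b, f' s * g s) := by
  intro ε hε
  obtain ⟨M, hM⟩ := isCompact_Icc.exists_bound_of_continuousOn (s := Set.Icc a b) hf'.continuousOn
  have hM0 : 0 ≤ M := (norm_nonneg _).trans (hM a ⟨le_rfl, hab⟩)
  have huc := isCompact_Icc.uniformContinuousOn_of_continuous (s := Set.Icc a b) hg.continuousOn
  rw [Metric.uniformContinuousOn_iff] at huc
  have hη : 0 < ε / (M * (b - a) + 1) := by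
    have : 0 ≤ M * (b - a) := mul_nonneg hM0 (sub_nonneg.2 hab)
    positivity
  set η := ε / (M * (b - a) + 1) with hηdef
  obtain ⟨δ, hδ, hδg⟩ := huc η hη
  refine ⟨δ, hδ, fun n u ξ h0 hn hu => ?_⟩
  have hmono : ∀ i, i ≤ n → ∀ j, j ≤ i → u j ≤ u i := by
    intro i
    induction i with
    | zero => intro _ j hj; rw [Nat.le_zero.1 hj]
    | succ i ih =>
      intro hi j hj
      rcases Nat.lt_or_eq_of_le hj with hj | hj
      · exact (ih (by omega) j (by omega)).trans ((hu i (by omega)).1.trans (hu i (by omega)).2.1)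
      · rw [hj]
  have hmem : ∀ i, i ≤ n → u i ∈ Set.Icc a b := fun i hi =>
    ⟨h0 ▸ hmono i hi 0 (Nat.zero_le _), hn ▸ hmono n le_rfl i hi⟩
  have hci : ∀ x y, IntervalIntegrable (fun s => f' s * g s) volume x y := fun x y =>
    (hf'.mul hg).intervalIntegrable x y
  have hcf : ∀ x y, IntervalIntegrable f' volume x y := fun x y => hf'.intervalIntegrable x y
  have hfund : ∀ x y, ∫ s in x..y, f' s = f y - f x := fun x y =>
    intervalIntegral.integral_eq_sub_of_hasDerivAt (fun z _ => hf z) (hcf x y)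
  have hshift : ∀ x y c, ∫ s in x..y, f' s * (g s - c)
      = (∫ s in x..y, f' s * g s) - (f y - f x) * c := by
    intro x y c
    simp_rw [mul_sub]
    rw [intervalIntegral.integral_sub (hci x y) ((hcf x y).mul_const c),
      intervalIntegral.integral_mul_const, hfund]
  have hbound : ∀ x y c, a ≤ x → x ≤ y → y ≤ b → (∀ s ∈ Set.Icc x y, |g s - g c| < η) →
      |∫ s in x..y, f' s * (g s - g c)| ≤ M * η * (y - x) := by
    intro x y c hax hxy hyb hs
    have := intervalIntegral.norm_integral_le_of_norm_le_const (a := x) (b := y)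
      (f := fun s => f' s * (g s - g c)) (C := M * η) (fun s hs' => by
        rw [Set.uIoc_of_le hxy] at hs'
        rw [norm_mul]
        exact mul_le_mul (hM s ⟨hax.trans hs'.1.le, hs'.2.trans hyb⟩)
          (hs s ⟨hs'.1.le, hs'.2⟩).le (norm_nonneg _) hM0)
    rwa [abs_of_nonneg (sub_nonneg.2 hxy)] at this
  have htele : f b * g b - f a * g a
      = ∑ i ∈ Finset.range n, (f (u (i + 1)) * g (u (i + 1)) - f (u i) * g (u i)) := by
    rw [Finset.sum_range_sub (fun i => f (u i) * g (u i)), h0, hn]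
  have hint : ∫ s in a..b, f' s * g s
      = ∑ i ∈ Finset.range n, ∫ s in u i..u (i + 1), f' s * g s := by
    rw [intervalIntegral.sum_integral_adjacent_intervals (fun k _ => hci _ _), h0, hn]
  have hlen : b - a = ∑ i ∈ Finset.range n, (u (i + 1) - u i) := by
    rw [Finset.sum_range_sub, h0, hn]
  -- Splitting the cell at its tag gives the exact error: `∫ f' (g - g(u_i))` up to the tag plus `∫
  -- f' (g - g(u_{i+1}))` after it. Both are controlled by the oscillation of `g`, so no bounded
  -- variation of `g` is needed.
  have hterm : ∀ i ∈ Finset.range n,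
      |f (ξ i) * (g (u (i + 1)) - g (u i))
        - (f (u (i + 1)) * g (u (i + 1)) - f (u i) * g (u i))
        + ∫ s in u i..u (i + 1), f' s * g s| ≤ M * η * (u (i + 1) - u i) := by
    intro i hi
    have hi := Finset.mem_range.1 hi
    obtain ⟨h1, h2, h3⟩ := hu i hi
    obtain ⟨ha1, hb1⟩ := hmem i hi.le
    obtain ⟨ha2, hb2⟩ := hmem (i + 1) hi
    have e1 := hbound (u i) (ξ i) (u i) ha1 h1 (h2.trans hb2) (fun s hs => by
      have := hδg s ⟨ha1.trans hs.1, hs.2.trans (h2.trans hb2)⟩ (u i) ⟨ha1, hb1⟩ (by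
        rw [Real.dist_eq, abs_of_nonneg (sub_nonneg.2 hs.1)]; linarith [hs.2])
      rwa [Real.dist_eq] at this)
    have e2 := hbound (ξ i) (u (i + 1)) (u (i + 1)) (ha1.trans h1) h2 hb2 (fun s hs => by
      have := hδg s ⟨(ha1.trans h1).trans hs.1, hs.2.trans hb2⟩ (u (i + 1)) ⟨ha2, hb2⟩ (by
        rw [Real.dist_eq, abs_sub_comm, abs_of_nonneg (sub_nonneg.2 hs.2)]; linarith [hs.1])
      rwa [Real.dist_eq] at this)
    rw [hshift] at e1 e2
    have hadd := intervalIntegral.integral_add_adjacent_intervals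
      (hci (u i) (ξ i)) (hci (ξ i) (u (i + 1)))
    calc _ = |((∫ s in u i..ξ i, f' s * g s) - (f (ξ i) - f (u i)) * g (u i))
          + ((∫ s in ξ i..u (i + 1), f' s * g s) - (f (u (i + 1)) - f (ξ i)) * g (u (i + 1)))| := by
          rw [← hadd]; congr 1; ring
      _ ≤ _ := (abs_add_le _ _).trans ((add_le_add e1 e2).trans (le_of_eq (by ring)))
  calc _ = |∑ i ∈ Finset.range n, (f (ξ i) * (g (u (i + 1)) - g (u i))
        - (f (u (i + 1)) * g (u (i + 1)) - f (u i) * g (u i))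
        + ∫ s in u i..u (i + 1), f' s * g s)| := by
        rw [htele, hint]; simp only [Finset.sum_add_distrib, Finset.sum_sub_distrib]; congr 1; ring
    _ ≤ ∑ i ∈ Finset.range n, M * η * (u (i + 1) - u i) :=
        (Finset.abs_sum_le_sum_abs _ _).trans (Finset.sum_le_sum hterm)
    _ = M * η * (b - a) := by rw [← Finset.mul_sum, ← hlen]
    _ < ε := by
        have h1 : 0 ≤ M * (b - a) := mul_nonneg hM0 (sub_nonneg.2 hab)
        have : η * (M * (b - a) + 1) = ε := by rw [hηdef]; field_simp
        nlinarith

theorem HasRSIntegral.rsIntegral_eq {f g : ℝ → ℝ} {a b I : ℝ} (hab : a ≤ b)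
    (h : HasRSIntegral f g a b I) : rsIntegral f g a b = I := by
  have hex : RSIntegrable f g a b := ⟨I, h⟩
  rw [rsIntegral, dif_pos hex]
  exact HasRSIntegral.unique hab hex.choose_spec h

theorem hasRSIntegral_exp {b : ℝ → ℝ} (hb : Continuous b) (h0 : b 0 = 0) (γ : ℝ) {t : ℝ}
    (ht : 0 ≤ t) :
    HasRSIntegral (fun s => Real.exp (-γ * (t - s))) b 0 t
      (b t - γ * Real.exp (-γ * t) * ∫ s in (0 : ℝ)..t, Real.exp (γ * s) * b s) := by
  have hd : ∀ x, HasDerivAt (fun s => Real.exp (-γ * (t - s)))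
      (γ * Real.exp (-γ * t) * Real.exp (γ * x)) x := by
    intro x
    have h1 : HasDerivAt (fun s : ℝ => -γ * (t - s)) (-γ * (-1)) x :=
      ((hasDerivAt_id x).const_sub t).const_mul (-γ)
    convert! h1.exp using 1
    rw [mul_assoc, ← Real.exp_add]
    ring_nf
  have := hasRSIntegral_of_hasDerivAt ht hd (by fun_prop) hb
  convert! this using 1
  simp only [h0, sub_self, mul_zero, Real.exp_zero, one_mul, sub_zero]
  simp_rw [mul_assoc]
  rw [intervalIntegral.integral_const_mul, intervalIntegral.integral_const_mul]

theorem fOU_eq {b : ℝ → ℝ} (hb : Continuous b) (h0 : b 0 = 0) (γ : ℝ) {t : ℝ} (ht : 0 ≤ t) :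
    fOU γ b t = b t - γ * Real.exp (-γ * t) * ∫ s in (0 : ℝ)..t, Real.exp (γ * s) * b s :=
  (hasRSIntegral_exp hb h0 γ ht).rsIntegral_eq ht

/-- The right-hand side of `fOU_eq`. -/
noncomputable def fOUPath (γ : ℝ) (b : ℝ → ℝ) (t : ℝ) : ℝ :=
  b t - γ * Real.exp (-γ * t) * ∫ s in (0 : ℝ)..t, Real.exp (γ * s) * b s

theorem hasDerivAt_integral_of_continuous {f : ℝ → ℝ} (hf : Continuous f) (a x : ℝ) :
    HasDerivAt (fun t => ∫ s in a..t, f s) (f x) x :=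
  intervalIntegral.integral_hasDerivAt_right (hf.intervalIntegrable _ _)
    hf.stronglyMeasurable.stronglyMeasurableAtFilter hf.continuousAt

theorem continuous_fOUPath {b : ℝ → ℝ} (hb : Continuous b) (γ : ℝ) :
    Continuous (fOUPath γ b) := by
  have : Continuous fun t => ∫ s in (0 : ℝ)..t, Real.exp (γ * s) * b s :=
    continuous_iff_continuousAt.2 fun x =>
      (hasDerivAt_integral_of_continuous (by fun_prop) 0 x).continuousAt
  unfold fOUPath
  fun_prop

theorem fOUEnergy_eq {b : ℝ → ℝ} (hb : Continuous b) (h0 : b 0 = 0) (γ : ℝ) :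
    fOUEnergy γ b = ∫ s in (0 : ℝ)..1, fOUPath γ b s ^ 2 := by
  refine intervalIntegral.integral_congr fun s hs => ?_
  rw [Set.uIcc_of_le zero_le_one] at hs
  simp only [fOU_eq hb h0 γ hs.1, fOUPath]

/-- Vanishing energy would make the transformed path zero on `[0,1]`. Then `F(t) = ∫_0^t e^{γ s} b_s
ds` solves `F' = γ F` with `F 0 = 0`, so `F` vanishes there and with it `b 1`. The exceptional null
set in the application is thus the same for all `γ`. -/
theorem fOUEnergy_pos {b : ℝ → ℝ} (hb : Continuous b) (h0 : b 0 = 0) (h1 : b 1 ≠ 0) (γ : ℝ) :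
    0 < fOUEnergy γ b := by
  rw [fOUEnergy_eq hb h0]
  have hc : Continuous fun s => fOUPath γ b s ^ 2 := (continuous_fOUPath hb γ).pow 2
  by_contra hneg
  have hzero : ∀ s ∈ Set.Icc (0 : ℝ) 1, fOUPath γ b s = 0 := by
    intro s hs
    by_contra hs0
    exact hneg (intervalIntegral.integral_pos zero_lt_one hc.continuousOn
      (fun x _ => sq_nonneg _) ⟨s, hs, by positivity⟩)
  set F : ℝ → ℝ := fun t => ∫ s in (0 : ℝ)..t, Real.exp (γ * s) * b s with hF
  have hFd : ∀ x, HasDerivAt F (Real.exp (γ * x) * b x) x := fun x =>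
    hasDerivAt_integral_of_continuous (by fun_prop) 0 x
  have hbF : ∀ s ∈ Set.Icc (0 : ℝ) 1, b s = γ * Real.exp (-γ * s) * F s := fun s hs => by
    have := hzero s hs
    simp only [fOUPath] at this
    linarith
  set E : ℝ → ℝ := fun t => Real.exp (-γ * t) * F t with hE
  have hlin : ∀ x, HasDerivAt (fun t : ℝ => -γ * t) (-γ) x := fun x => by
    simpa using (hasDerivAt_id x).const_mul (-γ)
  have hEd : ∀ x ∈ Set.Icc (0 : ℝ) 1, HasDerivAt E 0 x := by
    intro x hx
    have := (hlin x).exp.mul (hFd x)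
    convert! this using 1
    rw [hbF x hx]
    have : Real.exp (γ * x) * Real.exp (-γ * x) = 1 := by
      rw [← Real.exp_add]; simp
    linear_combination (-(γ * Real.exp (-γ * x) * F x)) * this
  have hE1 : E 1 = E 0 := constant_of_has_deriv_right_zero
    (fun x hx => (hEd x hx).continuousAt.continuousWithinAt)
    (fun x hx => (hEd x ⟨hx.1, hx.2.le⟩).hasDerivWithinAt) 1 ⟨zero_le_one, le_rfl⟩
  have hF0 : F 0 = 0 := by simp [hF]
  have hF1 : Real.exp (-γ * 1) * F 1 = 0 := by
    have : E 0 = 0 := by simp only [hE, hF0, mul_zero]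
    rw [← this, ← hE1]
  exact h1 (by rw [hbF 1 ⟨zero_le_one, le_rfl⟩, mul_assoc, hF1, mul_zero])

end Pathwise

/-! ### Deterministic approximation of energy and numerator by Laplace functionals. -/

section PathwiseAsymptotics

/-- The integral `∫_0^t l e^{-l s} b_s ds`. -/
noncomputable def laplaceAt (l : ℝ) (b : ℝ → ℝ) (t : ℝ) : ℝ :=
  l * ∫ s in (0 : ℝ)..t, Real.exp (-l * s) * b s

/-- The integral `∫_0^1 l e^{-l (1 - t)} (b_1 - b_t) dt`. -/
noncomputable def endpointLaplace (l : ℝ) (b : ℝ → ℝ) : ℝ :=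
  l * ∫ t in (0 : ℝ)..1, Real.exp (-l * (1 - t)) * (b 1 - b t)

theorem hasDerivAt_laplaceAt {b : ℝ → ℝ} (hb : Continuous b) (l t : ℝ) :
    HasDerivAt (laplaceAt l b) (l * (Real.exp (-l * t) * b t)) t :=
  (hasDerivAt_integral_of_continuous (by fun_prop) 0 t).const_mul l

theorem continuous_laplaceAt {b : ℝ → ℝ} (hb : Continuous b) (l : ℝ) :
    Continuous (laplaceAt l b) :=
  continuous_iff_continuousAt.2 fun t => (hasDerivAt_laplaceAt hb l t).continuousAt

theorem fOUPath_neg (l : ℝ) (b : ℝ → ℝ) (t : ℝ) :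
    fOUPath (-l) b t = b t + Real.exp (l * t) * laplaceAt l b t := by
  simp only [fOUPath, laplaceAt, neg_neg]
  ring

/-- Integrating the derivative of `e^{2 l t} V(t)^2` over `[0,1]` trades the dominant term `∫ e^{2 l
t} V^2` of the expanded square for its boundary value and a mixed integral; this halves the mixed
term of the expansion. -/
theorem mul_fOUEnergy_neg {b : ℝ → ℝ} (hb : Continuous b) (h0 : b 0 = 0) (l : ℝ) :
    2 * l * fOUEnergy (-l) b = Real.exp (2 * l) * laplaceAt l b 1 ^ 2
      + 2 * l * (∫ t in (0 : ℝ)..1, b t ^ 2)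
      + 2 * l * ∫ t in (0 : ℝ)..1, b t * Real.exp (l * t) * laplaceAt l b t := by
  have hV := continuous_laplaceAt hb l
  have hd : ∀ t, HasDerivAt (fun t => Real.exp (2 * l * t) * laplaceAt l b t ^ 2)
      (2 * l * (Real.exp (l * t) ^ 2 * laplaceAt l b t ^ 2
        + b t * Real.exp (l * t) * laplaceAt l b t)) t := by
    intro t
    have h1 : HasDerivAt (fun t : ℝ => 2 * l * t) (2 * l) t := by
      simpa using (hasDerivAt_id t).const_mul (2 * l)
    have := h1.exp.mul ((hasDerivAt_laplaceAt hb l t).pow 2)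
    convert! this using 1
    have e1 : Real.exp (2 * l * t) = Real.exp (l * t) ^ 2 := by
      rw [← Real.exp_nat_mul]; push_cast; ring_nf
    have e2 : Real.exp (l * t) * Real.exp (-l * t) = 1 := by rw [← Real.exp_add]; simp
    rw [e1]
    push_cast
    simp only [pow_one, Pi.pow_apply]
    linear_combination (-(2 * l * b t * laplaceAt l b t * Real.exp (l * t))) * e2
  have hfund := intervalIntegral.integral_eq_sub_of_hasDerivAt (a := 0) (b := 1)
    (fun t _ => hd t) (Continuous.intervalIntegrable (by fun_prop) _ _)
  have hV0 : laplaceAt l b 0 = 0 := by simp [laplaceAt]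
  rw [hV0, intervalIntegral.integral_const_mul, intervalIntegral.integral_add
    (Continuous.intervalIntegrable (by fun_prop) _ _)
    (Continuous.intervalIntegrable (by fun_prop) _ _)] at hfund
  have hJ : fOUEnergy (-l) b = (∫ t in (0 : ℝ)..1, b t ^ 2)
      + 2 * (∫ t in (0 : ℝ)..1, b t * Real.exp (l * t) * laplaceAt l b t)
      + ∫ t in (0 : ℝ)..1, Real.exp (l * t) ^ 2 * laplaceAt l b t ^ 2 := by
    rw [fOUEnergy_eq hb h0, ← intervalIntegral.integral_const_mul,
      ← intervalIntegral.integral_add (Continuous.intervalIntegrable (by fun_prop) _ _)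
      (Continuous.intervalIntegrable (by fun_prop) _ _),
      ← intervalIntegral.integral_add (Continuous.intervalIntegrable (by fun_prop) _ _)
      (Continuous.intervalIntegrable (by fun_prop) _ _)]
    refine intervalIntegral.integral_congr fun t _ => ?_
    simp only [fOUPath_neg]
    ring
  rw [hJ]
  simp only [mul_one] at hfund
  linarith

theorem endpointLaplace_eq {b : ℝ → ℝ} (hb : Continuous b) (l : ℝ) :
    endpointLaplace l b = b 1 * (1 - Real.exp (-l))
      - l * ∫ t in (0 : ℝ)..1, b t * Real.exp (-l * (1 - t)) := by
  have hd : ∀ t, HasDerivAt (fun t : ℝ => Real.exp (-l * (1 - t)))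
      (l * Real.exp (-l * (1 - t))) t := by
    intro t
    have := (((hasDerivAt_id t).const_sub 1).const_mul (-l)).exp
    convert! this using 1
    simp; ring
  have h := intervalIntegral.integral_eq_sub_of_hasDerivAt (a := 0) (b := 1)
    (fun t _ => hd t) (Continuous.intervalIntegrable (by fun_prop) _ _)
  rw [intervalIntegral.integral_const_mul] at h
  simp only [sub_self, mul_zero, Real.exp_zero, sub_zero, mul_one] at h
  have : ∫ t in (0 : ℝ)..1, Real.exp (-l * (1 - t)) * (b 1 - b t)
      = b 1 * (∫ t in (0 : ℝ)..1, Real.exp (-l * (1 - t)))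
        - ∫ t in (0 : ℝ)..1, b t * Real.exp (-l * (1 - t)) := by
    rw [← intervalIntegral.integral_const_mul, ← intervalIntegral.integral_sub
      (Continuous.intervalIntegrable (by fun_prop) _ _)
      (Continuous.intervalIntegrable (by fun_prop) _ _)]
    refine intervalIntegral.integral_congr fun t _ => ?_
    ring
  rw [endpointLaplace, this]
  linear_combination b 1 * h

theorem laplaceAt_sub_abs_le {b : ℝ → ℝ} (hb : Continuous b) {l M : ℝ} (hl : 0 < l)
    (hM : ∀ t ∈ Set.Icc (0 : ℝ) 1, |b t| ≤ M) {s t : ℝ} (hs : 0 ≤ s) (hst : s ≤ t) (ht : t ≤ 1) :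
    |laplaceAt l b t - laplaceAt l b s| ≤ M * Real.exp (-l * s) := by
  have hM0 : 0 ≤ M := (abs_nonneg _).trans (hM 0 ⟨le_rfl, zero_le_one⟩)
  have hd : ∀ t, HasDerivAt (fun t : ℝ => -Real.exp (-l * t)) (l * Real.exp (-l * t)) t := by
    intro t
    have := (((hasDerivAt_id t).const_mul (-l)).exp).neg
    convert! this using 1
    simp; ring
  have h := intervalIntegral.integral_eq_sub_of_hasDerivAt (a := s) (b := t)
    (fun t _ => hd t) (Continuous.intervalIntegrable (by fun_prop) _ _)
  have hsub : laplaceAt l b t - laplaceAt l b s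
      = ∫ r in s..t, l * (Real.exp (-l * r) * b r) :=
    (intervalIntegral.integral_eq_sub_of_hasDerivAt (fun t _ => hasDerivAt_laplaceAt hb l t)
      (Continuous.intervalIntegrable (by fun_prop) _ _)).symm
  rw [hsub]
  calc |∫ r in s..t, l * (Real.exp (-l * r) * b r)|
      ≤ ∫ r in s..t, M * (l * Real.exp (-l * r)) :=
        intervalIntegral.norm_integral_le_of_norm_le
          (f := fun r => l * (Real.exp (-l * r) * b r)) (g := fun r => M * (l * Real.exp (-l * r)))
          hst (ae_of_all _ fun r hr => by
            rw [Real.norm_eq_abs, abs_mul l, abs_mul (Real.exp _), abs_of_pos hl, Real.abs_exp]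
            have := hM r ⟨hs.trans hr.1.le, hr.2.trans ht⟩
            have : l * Real.exp (-l * r) * |b r| ≤ l * Real.exp (-l * r) * M := by gcongr
            linarith)
          (Continuous.intervalIntegrable (by fun_prop) _ _)
    _ = M * (Real.exp (-l * s) - Real.exp (-l * t)) := by
        rw [intervalIntegral.integral_const_mul, h]; ring
    _ ≤ M * Real.exp (-l * s) := by
        gcongr; linarith [Real.exp_pos (-l * t)]

theorem abs_integral_zero_one_le {f : ℝ → ℝ} {C : ℝ} (h : ∀ t ∈ Set.Icc (0 : ℝ) 1, |f t| ≤ C) :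
    |∫ t in (0 : ℝ)..1, f t| ≤ C := by
  have := intervalIntegral.norm_integral_le_of_norm_le_const (a := 0) (b := 1) (f := f) (C := C)
    (fun t ht => by
      rw [Set.uIoc_of_le zero_le_one] at ht
      exact h t ⟨ht.1.le, ht.2⟩)
  simpa using this

theorem laplaceAt_abs_le {b : ℝ → ℝ} (hb : Continuous b) {l M : ℝ} (hl : 0 < l)
    (hM : ∀ t ∈ Set.Icc (0 : ℝ) 1, |b t| ≤ M) {t : ℝ} (ht : t ∈ Set.Icc (0 : ℝ) 1) :
    |laplaceAt l b t| ≤ M := by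
  have := laplaceAt_sub_abs_le hb hl hM le_rfl ht.1 ht.2
  simpa [laplaceAt] using this

/-- In the exact energy identity the two remaining integrals are at most `M^2` and `M^2 e^l`, so the
factor `e^{-2 l}` leaves an error of order `l e^{-l}`. -/
theorem abs_exp_mul_fOUEnergy_sub_le {b : ℝ → ℝ} (hb : Continuous b) (h0 : b 0 = 0) {l M : ℝ}
    (hl : 0 < l) (hM : ∀ t ∈ Set.Icc (0 : ℝ) 1, |b t| ≤ M) :
    |2 * l * Real.exp (-2 * l) * fOUEnergy (-l) b - laplaceAt l b 1 ^ 2|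
      ≤ 4 * M ^ 2 * (l * Real.exp (-l)) := by
  have hM0 : 0 ≤ M := (abs_nonneg _).trans (hM 0 ⟨le_rfl, zero_le_one⟩)
  have h1 : |∫ t in (0 : ℝ)..1, b t ^ 2| ≤ M ^ 2 := abs_integral_zero_one_le fun t ht => by
    rw [abs_pow]; exact pow_le_pow_left₀ (abs_nonneg _) (hM t ht) 2
  have h2 : |∫ t in (0 : ℝ)..1, b t * Real.exp (l * t) * laplaceAt l b t|
      ≤ M * Real.exp l * M := abs_integral_zero_one_le fun t ht => by
    rw [abs_mul, abs_mul, Real.abs_exp]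
    have : Real.exp (l * t) ≤ Real.exp l := Real.exp_le_exp.2 (by nlinarith [ht.2])
    exact mul_le_mul (mul_le_mul (hM t ht) this (Real.exp_pos _).le hM0)
      (laplaceAt_abs_le hb hl hM ht) (abs_nonneg _) (by positivity)
  have e1 : Real.exp (-2 * l) * Real.exp (2 * l) = 1 := by rw [← Real.exp_add]; simp
  have e2 : Real.exp (-2 * l) * Real.exp l = Real.exp (-l) := by rw [← Real.exp_add]; ring_nf
  have e3 : Real.exp (-2 * l) ≤ Real.exp (-l) := Real.exp_le_exp.2 (by linarith)
  have key : 2 * l * Real.exp (-2 * l) * fOUEnergy (-l) b - laplaceAt l b 1 ^ 2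
      = 2 * l * Real.exp (-2 * l) * ((∫ t in (0 : ℝ)..1, b t ^ 2)
        + ∫ t in (0 : ℝ)..1, b t * Real.exp (l * t) * laplaceAt l b t) := by
    linear_combination Real.exp (-2 * l) * mul_fOUEnergy_neg hb h0 l
      + laplaceAt l b 1 ^ 2 * e1
  rw [key, abs_mul, abs_of_pos (by positivity)]
  calc _ ≤ 2 * l * Real.exp (-2 * l) * (M ^ 2 + M * Real.exp l * M) := by
        gcongr; exact (abs_add_le _ _).trans (add_le_add h1 h2)
    _ = 2 * l * M ^ 2 * (Real.exp (-2 * l) + Real.exp (-l)) := by rw [← e2]; ring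
    _ ≤ 2 * l * M ^ 2 * (Real.exp (-l) + Real.exp (-l)) := by gcongr
    _ = _ := by ring

/-- The term `e^{2 l} V(1)^2 / 2` occurs both in half the squared endpoint and in `l` times the
energy, and cancels. Of what is left, the part of order `e^l` is `V(1) b_1 - l ∫ b_t e^{-l(1-t)}
V(t) dt`; replacing `V(t)` by `V(1)` produces the product of the two functionals. This replacement
is cheap because `e^{-l(1-t)}` times the tail bound `M e^{-l t}` equals `M e^{-l}` for every `t`. -/
theorem abs_exp_mul_numerator_sub_le {b : ℝ → ℝ} (hb : Continuous b) (h0 : b 0 = 0) {l M : ℝ}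
    (hl : 0 < l) (hM : ∀ t ∈ Set.Icc (0 : ℝ) 1, |b t| ≤ M) :
    |Real.exp (-l) * (fOU (-l) b 1 ^ 2 / 2 + -l * fOUEnergy (-l) b)
        - laplaceAt l b 1 * endpointLaplace l b| ≤ 2 * M ^ 2 * ((1 + l) * Real.exp (-l)) := by
  have hM0 : 0 ≤ M := (abs_nonneg _).trans (hM 0 ⟨le_rfl, zero_le_one⟩)
  have hV := continuous_laplaceAt hb l
  have h1 : |∫ t in (0 : ℝ)..1, b t ^ 2| ≤ M ^ 2 := abs_integral_zero_one_le fun t ht => by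
    rw [abs_pow]; exact pow_le_pow_left₀ (abs_nonneg _) (hM t ht) 2
  have m1 : (1 : ℝ) ∈ Set.Icc (0 : ℝ) 1 := ⟨zero_le_one, le_rfl⟩
  have hb1 := hM 1 m1
  have hV1 := laplaceAt_abs_le hb hl hM m1
  have h2 : |∫ t in (0 : ℝ)..1, b t * Real.exp (-l * (1 - t))
      * (laplaceAt l b 1 - laplaceAt l b t)| ≤ M ^ 2 * Real.exp (-l) :=
    abs_integral_zero_one_le fun t ht => by
      rw [abs_mul, abs_mul, Real.abs_exp]
      calc |b t| * Real.exp (-l * (1 - t)) * |laplaceAt l b 1 - laplaceAt l b t|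
          ≤ M * Real.exp (-l * (1 - t)) * (M * Real.exp (-l * t)) := by
            gcongr
            · exact hM t ht
            · exact laplaceAt_sub_abs_le hb hl hM ht.1 ht.2 le_rfl
        _ = M ^ 2 * (Real.exp (-l * (1 - t)) * Real.exp (-l * t)) := by ring
        _ = _ := by rw [← Real.exp_add]; ring_nf
  have e1 : Real.exp (-l) * Real.exp l = 1 := by rw [← Real.exp_add]; simp
  have e2 : Real.exp (2 * l) = Real.exp l ^ 2 := by rw [← Real.exp_nat_mul]; push_cast; rfl
  have hsplit : ∫ t in (0 : ℝ)..1, b t * Real.exp (-l * (1 - t))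
      * (laplaceAt l b 1 - laplaceAt l b t)
      = laplaceAt l b 1 * (∫ t in (0 : ℝ)..1, b t * Real.exp (-l * (1 - t)))
        - Real.exp (-l) * ∫ t in (0 : ℝ)..1, b t * Real.exp (l * t) * laplaceAt l b t := by
    rw [← intervalIntegral.integral_const_mul, ← intervalIntegral.integral_const_mul,
      ← intervalIntegral.integral_sub (Continuous.intervalIntegrable (by fun_prop) _ _)
      (Continuous.intervalIntegrable (by fun_prop) _ _)]
    refine intervalIntegral.integral_congr fun t _ => ?_
    have : Real.exp (-l * (1 - t)) = Real.exp (-l) * Real.exp (l * t) := by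
      rw [← Real.exp_add]; ring_nf
    simp only [this]
    ring
  have hX : fOU (-l) b 1 = b 1 + Real.exp l * laplaceAt l b 1 := by
    have := fOUPath_neg l b 1
    rw [mul_one] at this
    rw [← this]
    exact fOU_eq hb h0 (-l) zero_le_one
  have key : Real.exp (-l) * (fOU (-l) b 1 ^ 2 / 2 + -l * fOUEnergy (-l) b)
        - laplaceAt l b 1 * endpointLaplace l b
      = Real.exp (-l) * (b 1 ^ 2 / 2 - l * (∫ t in (0 : ℝ)..1, b t ^ 2) + laplaceAt l b 1 * b 1)
        + l * ∫ t in (0 : ℝ)..1, b t * Real.exp (-l * (1 - t))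
      * (laplaceAt l b 1 - laplaceAt l b t) := by
    have hm := mul_fOUEnergy_neg hb h0 l
    rw [e2] at hm
    rw [hX, hsplit, endpointLaplace_eq hb]
    linear_combination (-Real.exp (-l) / 2) * hm + (laplaceAt l b 1 * b 1) * e1
  rw [key]
  have h3 : |b 1 ^ 2 / 2 - l * (∫ t in (0 : ℝ)..1, b t ^ 2) + laplaceAt l b 1 * b 1|
      ≤ M ^ 2 / 2 + l * M ^ 2 + M * M := by
    refine (abs_add_le _ _).trans (add_le_add ((abs_sub _ _).trans (add_le_add ?_ ?_)) ?_)
    · rw [abs_div, abs_pow, abs_two]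
      gcongr
    · rw [abs_mul, abs_of_pos hl]; gcongr
    · rw [abs_mul]; gcongr
  calc _ ≤ Real.exp (-l) * (M ^ 2 / 2 + l * M ^ 2 + M * M) + l * (M ^ 2 * Real.exp (-l)) := by
        refine (abs_add_le _ _).trans (add_le_add ?_ ?_)
        · rw [abs_mul, Real.abs_exp]; gcongr
        · rw [abs_mul, abs_of_pos hl]; gcongr
    _ ≤ _ := by nlinarith [mul_nonneg (sq_nonneg M) (Real.exp_pos (-l)).le]

theorem tendsto_rpow_mul_mul_exp_neg (q : ℝ) (C : ℝ) :
    Tendsto (fun l : ℝ => C * (l ^ q * Real.exp (-l))) atTop (𝓝 0) := by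
  have := (tendsto_rpow_mul_exp_neg_mul_atTop_nhds_zero q 1 one_pos).const_mul C
  simpa using this

theorem tendsto_scaled_fOUEnergy_sub {b : ℝ → ℝ} (hb : Continuous b) (h0 : b 0 = 0) (H : ℝ) :
    Tendsto (fun l : ℝ => l ^ (2 * H) * (2 * l * Real.exp (-2 * l) * fOUEnergy (-l) b)
      - (l ^ H * laplaceAt l b 1) ^ 2) atTop (𝓝 0) := by
  obtain ⟨M, hM⟩ := isCompact_Icc.exists_bound_of_continuousOn (s := Set.Icc (0 : ℝ) 1)
    hb.continuousOn
  refine squeeze_zero_norm' ?_ (tendsto_rpow_mul_mul_exp_neg (2 * H + 1) (4 * M ^ 2))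
  filter_upwards [eventually_gt_atTop 0] with l hl
  have h := abs_exp_mul_fOUEnergy_sub_le hb h0 hl hM
  have e : (l ^ H) ^ 2 = l ^ (2 * H) := by
    rw [← Real.rpow_natCast, ← Real.rpow_mul hl.le]; push_cast; ring_nf
  have hp : 0 < l ^ (2 * H) := Real.rpow_pos_of_pos hl _
  rw [mul_pow, e, ← mul_sub, Real.norm_eq_abs, abs_mul, abs_of_pos hp, Real.rpow_add_one hl.ne']
  calc _ ≤ l ^ (2 * H) * (4 * M ^ 2 * (l * Real.exp (-l))) := by gcongr
    _ = _ := by ring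

theorem tendsto_scaled_numerator_sub {b : ℝ → ℝ} (hb : Continuous b) (h0 : b 0 = 0) (H : ℝ) :
    Tendsto (fun l : ℝ => l ^ (2 * H) * (Real.exp (-l) *
        (fOU (-l) b 1 ^ 2 / 2 + -l * fOUEnergy (-l) b))
      - (l ^ H * laplaceAt l b 1) * (l ^ H * endpointLaplace l b)) atTop (𝓝 0) := by
  obtain ⟨M, hM⟩ := isCompact_Icc.exists_bound_of_continuousOn (s := Set.Icc (0 : ℝ) 1)
    hb.continuousOn
  refine squeeze_zero_norm' ?_ (add_zero (0 : ℝ) ▸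
    (tendsto_rpow_mul_mul_exp_neg (2 * H) (2 * M ^ 2)).add
      (tendsto_rpow_mul_mul_exp_neg (2 * H + 1) (2 * M ^ 2)))
  filter_upwards [eventually_gt_atTop 0] with l hl
  have h := abs_exp_mul_numerator_sub_le hb h0 hl hM
  have e : l ^ H * l ^ H = l ^ (2 * H) := by
    rw [← Real.rpow_add hl]; ring_nf
  have hp : 0 < l ^ (2 * H) := Real.rpow_pos_of_pos hl _
  rw [mul_mul_mul_comm, e, ← mul_sub, Real.norm_eq_abs, abs_mul, abs_of_pos hp,
    Real.rpow_add_one hl.ne']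
  calc _ ≤ l ^ (2 * H) * (2 * M ^ 2 * ((1 + l) * Real.exp (-l))) := by gcongr
    _ = _ := by ring

end PathwiseAsymptotics

/-! ### Integrals of Gaussian processes as limits of Riemann sums. -/

section GaussianIntegrals

/-- The Riemann sum of `F` over the partition of `[0, T]` into `n` equal parts. -/
noncomputable def riemannSum (T : ℝ) (n : ℕ) (F : ℝ → ℝ) : ℝ :=
  ∑ k ∈ Finset.range n, T / n * F (k * (T / n))

theorem abs_riemannSum_sub_le {T w : ℝ} (hT : 0 ≤ T) {n : ℕ} (hn : n ≠ 0) {F : ℝ → ℝ}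
    (hF : Continuous F)
    (hw : ∀ x ∈ Set.Icc 0 T, ∀ y ∈ Set.Icc 0 T, |x - y| ≤ T / n → |F x - F y| ≤ w) :
    |riemannSum T n F - ∫ x in (0 : ℝ)..T, F x| ≤ T * w := by
  have hn0 : (0 : ℝ) < n := by positivity
  set d := T / n with hd
  have hd0 : 0 ≤ d := by positivity
  have hnd : n * d = T := by rw [hd]; field_simp
  have hint : ∫ x in (0 : ℝ)..T, F x
      = ∑ k ∈ Finset.range n, ∫ x in (k * d)..((k + 1 : ℕ) * d), F x := by
    rw [intervalIntegral.sum_integral_adjacent_intervals (a := fun k : ℕ => (k : ℝ) * d)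
      (fun k _ => hF.intervalIntegrable _ _), hnd]
    simp
  rw [riemannSum, hint, ← Finset.sum_sub_distrib]
  refine (Finset.abs_sum_le_sum_abs _ _).trans ?_
  calc _ ≤ ∑ k ∈ Finset.range n, w * d := by
        refine Finset.sum_le_sum fun k hk => ?_
        have hk1 : ((k + 1 : ℕ) : ℝ) ≤ n := by exact_mod_cast Finset.mem_range.1 hk
        have hlen : ((k + 1 : ℕ) : ℝ) * d - k * d = d := by push_cast; ring
        have hle : (k : ℝ) * d ≤ ((k + 1 : ℕ) : ℝ) * d := by linarith
        have hT' : ((k + 1 : ℕ) : ℝ) * d ≤ T := hnd ▸ mul_le_mul_of_nonneg_right hk1 hd0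
        have hk0 : 0 ≤ (k : ℝ) * d := by positivity
        have hconst : d * F (k * d) = ∫ x in (k * d)..((k + 1 : ℕ) * d), F (k * d) := by
          rw [intervalIntegral.integral_const, hlen, smul_eq_mul]
        rw [hconst, ← intervalIntegral.integral_sub (by simp) (hF.intervalIntegrable _ _)]
        have := intervalIntegral.norm_integral_le_of_norm_le_const (a := (k : ℝ) * d)
          (b := ((k + 1 : ℕ) : ℝ) * d) (f := fun x => F (k * d) - F x) (C := w) (fun x hx => by
            rw [Set.uIoc_of_le hle] at hx
            refine hw _ ⟨hk0, hle.trans hT'⟩ _ ⟨hk0.trans hx.1.le, hx.2.trans hT'⟩ ?_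
            rw [abs_sub_comm, abs_of_nonneg (by linarith [hx.1])]
            linarith [hx.2])
        rwa [hlen, abs_of_nonneg hd0] at this
    _ = T * w := by rw [Finset.sum_const, Finset.card_range, nsmul_eq_mul, ← hnd]; ring

theorem tendsto_div_nat_zero (T : ℝ) : Tendsto (fun n : ℕ => T / (n : ℝ)) atTop (𝓝 0) :=
  tendsto_const_nhds.div_atTop tendsto_natCast_atTop_atTop

theorem tendsto_of_eventually_abs_sub_le {u : ℕ → ℝ} {a C : ℝ}
    (h : ∀ w > 0, ∀ᶠ n in atTop, |u n - a| ≤ C * w) : Tendsto u atTop (𝓝 a) := by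
  rw [Metric.tendsto_nhds]
  intro ε hε
  have hC : 0 < |C| + 1 := by positivity
  filter_upwards [h (ε / (|C| + 1)) (by positivity)] with n hn
  rw [Real.dist_eq]
  refine hn.trans_lt ?_
  have : ε / (|C| + 1) * (|C| + 1) = ε := by field_simp
  nlinarith [le_abs_self C, div_pos hε hC]

theorem tendsto_riemannSum {T : ℝ} (hT : 0 ≤ T) {F : ℝ → ℝ} (hF : Continuous F) :
    Tendsto (fun n => riemannSum T n F) atTop (𝓝 (∫ x in (0 : ℝ)..T, F x)) := by
  refine tendsto_of_eventually_abs_sub_le (C := T) fun w hw => ?_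
  have huc := isCompact_Icc.uniformContinuousOn_of_continuous (s := Set.Icc 0 T) hF.continuousOn
  rw [Metric.uniformContinuousOn_iff] at huc
  obtain ⟨δ, hδ, h⟩ := huc w hw
  filter_upwards [(tendsto_div_nat_zero T).eventually_lt_const hδ, eventually_ne_atTop 0]
    with n hn hn0
  refine abs_riemannSum_sub_le hT hn0 hF fun x hx y hy hxy => ?_
  exact (h x hx y hy (lt_of_le_of_lt hxy hn)).le

theorem riemannSum_sub (T : ℝ) (n : ℕ) (F G : ℝ → ℝ) :
    riemannSum T n (fun x => F x - G x) = riemannSum T n F - riemannSum T n G := by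
  simp only [riemannSum, mul_sub, Finset.sum_sub_distrib]

theorem abs_riemannSum_le {T w : ℝ} (hT : 0 ≤ T) {n : ℕ} (hn : n ≠ 0) {F : ℝ → ℝ}
    (hw : ∀ x ∈ Set.Icc 0 T, |F x| ≤ w) : |riemannSum T n F| ≤ T * w := by
  have hn0 : (0 : ℝ) < n := by positivity
  have hd0 : 0 ≤ T / n := by positivity
  have hnd : n * (T / n) = T := by field_simp
  refine (Finset.abs_sum_le_sum_abs _ _).trans ?_
  calc _ ≤ ∑ k ∈ Finset.range n, T / n * w := by
        refine Finset.sum_le_sum fun k hk => ?_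
        rw [abs_mul, abs_of_nonneg hd0]
        refine mul_le_mul_of_nonneg_left (hw _ ⟨by positivity, ?_⟩) hd0
        have hk1 : (k : ℝ) ≤ n := by exact_mod_cast (Finset.mem_range.1 hk).le
        exact (mul_le_mul_of_nonneg_right hk1 hd0).trans_eq hnd
    _ = T * w := by
        rw [Finset.sum_const, Finset.card_range, nsmul_eq_mul, ← mul_assoc, hnd]

theorem tendsto_riemannSum_riemannSum {T : ℝ} (hT : 0 ≤ T) {K : ℝ → ℝ → ℝ}
    (hK : Continuous (Function.uncurry K)) :
    Tendsto (fun n => riemannSum T n fun x => riemannSum T n (K x)) atTop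
      (𝓝 (∫ x in (0 : ℝ)..T, ∫ y in (0 : ℝ)..T, K x y)) := by
  have hKx : ∀ x, Continuous (K x) := fun x => hK.comp (by fun_prop : Continuous fun y => (x, y))
  have hI : Continuous fun x => ∫ y in (0 : ℝ)..T, K x y :=
    intervalIntegral.continuous_parametric_intervalIntegral_of_continuous' hK 0 T
  have h1 := tendsto_riemannSum hT hI
  -- Uniform continuity on the square makes the inner Riemann sums converge uniformly in the outer
  -- variable.
  have h2 : Tendsto (fun n => riemannSum T n (fun x => riemannSum T n (K x))
      - riemannSum T n (fun x => ∫ y in (0 : ℝ)..T, K x y)) atTop (𝓝 0) := by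
    refine tendsto_of_eventually_abs_sub_le (C := T * T) fun w hw => ?_
    have huc := (isCompact_Icc.prod isCompact_Icc).uniformContinuousOn_of_continuous
      (s := Set.Icc 0 T ×ˢ Set.Icc 0 T) hK.continuousOn
    rw [Metric.uniformContinuousOn_iff] at huc
    obtain ⟨δ, hδ, h⟩ := huc w hw
    filter_upwards [(tendsto_div_nat_zero T).eventually_lt_const hδ, eventually_ne_atTop 0]
      with n hn hn0
    rw [sub_zero, ← riemannSum_sub, mul_assoc]
    refine abs_riemannSum_le hT hn0 fun x hx => ?_
    refine abs_riemannSum_sub_le hT hn0 (hKx x) fun y hy z hz hyz => ?_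
    refine (h (x, y) ⟨hx, hy⟩ (x, z) ⟨hx, hz⟩ ?_).le
    rw [Prod.dist_eq, dist_self, Real.dist_eq]
    exact max_lt hδ (lt_of_le_of_lt hyz hn)
  simpa using h2.add h1

variable {Ω : Type*} [MeasurableSpace Ω] {P : Measure Ω}

/-- Riemann sums are measurable and converge along continuous paths, so joint measurability of the
process is not required. -/
theorem aemeasurable_intervalIntegral_of_continuous {X : ℝ → Ω → ℝ} {T : ℝ} (hT : 0 ≤ T)
    (hX : ∀ t, 0 ≤ t → AEMeasurable (X t) P) (hc : ∀ᵐ ω ∂P, Continuous fun t => X t ω) :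
    AEMeasurable (fun ω => ∫ t in (0 : ℝ)..T, X t ω) P := by
  refine aemeasurable_of_tendsto_metrizable_ae atTop
    (f := fun n ω => riemannSum T n fun t => X t ω) (fun n => ?_) ?_
  · unfold riemannSum
    exact Finset.aemeasurable_fun_sum _ fun k _ => (hX _ (by positivity)).const_mul _
  · filter_upwards [hc] with ω hω
    exact tendsto_riemannSum hT hω

theorem ProbabilityTheory.HasGaussianLaw.integral_exp_mul_I {X : Ω → ℝ} (hX : HasGaussianLaw X P)
    (h0 : ∫ ω, X ω ∂P = 0) :
    ∫ ω, Complex.exp (X ω * Complex.I) ∂P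
      = Complex.exp (-((∫ ω, X ω ^ 2 ∂P : ℝ) : ℂ) / 2) := by
  have h := hX.charFun_map_eq 1
  rw [charFun_apply, integral_map hX.aemeasurable (by fun_prop)] at h
  simp only [RCLike.inner_apply, map_one, mul_one, conj_trivial, one_mul] at h
  rw [h, h0, variance_of_integral_eq_zero hX.aemeasurable h0]
  simp [neg_div]

/-- A Riemann sum is a centered Gaussian variable whose variance is the double Riemann sum of the
covariance. Both sides of its characteristic function formula pass to the limit, the left one by
dominated convergence with bound 1. -/
theorem ProbabilityTheory.IsGaussianProcess.integral_exp_intervalIntegral {G : ℝ → Ω → ℝ}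
    (hG : IsGaussianProcess G P) (h0 : ∀ t, ∫ ω, G t ω ∂P = 0)
    (hc : ∀ᵐ ω ∂P, Continuous fun t => G t ω) {K : ℝ → ℝ → ℝ}
    (hK : Continuous (Function.uncurry K)) (hcov : ∀ s t, ∫ ω, G s ω * G t ω ∂P = K s t)
    {T : ℝ} (hT : 0 ≤ T) :
    ∫ ω, Complex.exp ((∫ t in (0 : ℝ)..T, G t ω : ℝ) * Complex.I) ∂P
      = Complex.exp (-((∫ s in (0 : ℝ)..T, ∫ t in (0 : ℝ)..T, K s t : ℝ) : ℂ) / 2) := by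
  have := hG.isProbabilityMeasure
  have hi : ∀ t, Integrable (G t) P := fun t => (hG.hasGaussianLaw_eval t).integrable
  have hL2 : ∀ t, MemLp (G t) 2 P := fun t => (hG.hasGaussianLaw_eval t).memLp_two
  have hlaw : ∀ n : ℕ, HasGaussianLaw (fun ω => riemannSum T n fun t => G t ω) P := fun n =>
    ((hG.comp_right fun k : ℕ => (k : ℝ) * (T / n)).smul
      fun _ => T / n).hasGaussianLaw_fun_sum (I := Finset.range n)
  have hmean : ∀ n : ℕ, ∫ ω, (riemannSum T n fun t => G t ω) ∂P = 0 := fun n => by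
    simp only [riemannSum]
    rw [integral_finsetSum _ fun k _ => (hi _).const_mul _]
    simp [integral_const_mul, h0]
  have hvar : ∀ n : ℕ, ∫ ω, (riemannSum T n fun t => G t ω) ^ 2 ∂P
      = riemannSum T n fun s => riemannSum T n (K s) := fun n => by
    have hint : ∀ s t, Integrable (fun ω => T / n * G s ω * (T / n * G t ω)) P := fun s t =>
      ((hL2 s).const_mul (T / n)).integrable_mul ((hL2 t).const_mul (T / n))
    simp only [riemannSum, sq, Finset.sum_mul_sum]
    rw [integral_finsetSum _ fun k _ => integrable_finsetSum _ fun l _ => hint _ _]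
    refine Finset.sum_congr rfl fun k _ => ?_
    rw [integral_finsetSum _ fun l _ => hint _ _, Finset.mul_sum]
    refine Finset.sum_congr rfl fun l _ => ?_
    rw [← hcov, ← integral_const_mul, ← integral_const_mul]
    refine integral_congr_ae (ae_of_all _ fun ω => ?_)
    simp only
    ring
  have hlim1 : Tendsto (fun n : ℕ => ∫ ω, Complex.exp
      ((riemannSum T n fun t => G t ω : ℝ) * Complex.I) ∂P) atTop
      (𝓝 (∫ ω, Complex.exp ((∫ t in (0 : ℝ)..T, G t ω : ℝ) * Complex.I) ∂P)) := by
    refine tendsto_integral_of_dominated_convergence (fun _ => 1) (fun n => ?_)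
      (integrable_const _) (fun n => ?_) ?_
    · exact Continuous.comp_aestronglyMeasurable (g := fun x : ℝ => Complex.exp (x * Complex.I))
        (by fun_prop) (hlaw n).aemeasurable.aestronglyMeasurable
    · exact ae_of_all _ fun ω => (Complex.norm_exp_ofReal_mul_I _).le
    · filter_upwards [hc] with ω hω
      exact (Continuous.tendsto (f := fun x : ℝ => Complex.exp (x * Complex.I))
        (by fun_prop) _).comp (tendsto_riemannSum hT hω)
  have hlim2 := (Continuous.tendsto (f := fun x : ℝ => Complex.exp (-(x : ℂ) / 2))
        (by fun_prop) _).comp (tendsto_riemannSum_riemannSum hT hK)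
  refine tendsto_nhds_unique hlim1 (hlim2.congr fun n => ?_)
  rw [(hlaw n).integral_exp_mul_I (hmean n), hvar]
  rfl

end GaussianIntegrals

/-! ### Limits of the Laplace-weighted covariance integrals. -/

section CovarianceAsymptotics

/-- First-order Taylor expansion at 0 for `x ≤ 1/2`, through bounds on `log` and `exp`. For `x ≥
1/2` the right side is at least 4 and crude bounds suffice. The range up to 2 accommodates `x = s +
t`. -/
theorem abs_abs_one_sub_rpow_sub_le {p x : ℝ} (hp0 : 0 < p) (hp2 : p < 2) (hx0 : 0 ≤ x)
    (hx2 : x ≤ 2) : |(|1 - x| ^ p - (1 - p * x))| ≤ 16 * x ^ 2 := by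
  rcases le_total x (1 / 2) with hx | hx
  · have h1 : 0 < 1 - x := by linarith
    rw [abs_of_pos h1, Real.rpow_def_of_pos h1, abs_le]
    have hpx : p * x ≤ 1 := by nlinarith
    constructor
    · have hlog : -(x / (1 - x)) ≤ Real.log (1 - x) := by
        have := Real.one_sub_inv_le_log_of_pos h1
        have e : 1 - (1 - x)⁻¹ = -(x / (1 - x)) := by field_simp; ring
        rwa [e] at this
      have hdiv : x / (1 - x) ≤ x + 2 * x ^ 2 := by
        rw [div_le_iff₀ h1]; nlinarith [mul_nonneg (sq_nonneg x) (sub_nonneg.2 hx)]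
      have := Real.add_one_le_exp (Real.log (1 - x) * p)
      nlinarith [sq_nonneg x]
    · have hlog : Real.log (1 - x) ≤ -x := by
        have := Real.log_le_sub_one_of_pos h1; linarith
      have hexp : Real.exp (Real.log (1 - x) * p) ≤ Real.exp (-(p * x)) :=
        Real.exp_le_exp.2 (by nlinarith)
      have hb := Real.abs_exp_sub_one_sub_id_le (x := -(p * x)) (by
        rw [abs_neg, abs_of_nonneg (by positivity)]; exact hpx)
      have := (abs_le.1 hb).2
      have hpx2 : (p * x) ^ 2 ≤ (2 * x) ^ 2 := by gcongr
      nlinarith [sq_nonneg x]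
  · have h1 : |1 - x| ≤ 1 := by rw [abs_le]; constructor <;> linarith
    have h2 : |1 - x| ^ p ≤ 1 := Real.rpow_le_one (abs_nonneg _) h1 hp0.le
    have h3 : 0 ≤ |1 - x| ^ p := by positivity
    rw [abs_le]
    constructor <;> nlinarith

/-- The covariance `E B_s B_t` of a fractional Brownian motion. -/
noncomputable def fbmCov (H s t : ℝ) : ℝ :=
  (1 / 2) * (|s| ^ (2 * H) + |t| ^ (2 * H) - |s - t| ^ (2 * H))

/-- The covariance `E B_s (B_1 - B_{1 - t})` for a fractional Brownian motion. -/
noncomputable def fbmCrossCov (H s t : ℝ) : ℝ :=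
  (1 / 2) * (1 - |1 - s| ^ (2 * H) - |1 - t| ^ (2 * H) + |1 - (s + t)| ^ (2 * H))

/-- The constant and linear Taylor terms cancel in the second difference, so only the quadratic
remainders survive. This is the source of asymptotic independence. -/
theorem abs_fbmCrossCov_le {H : ℝ} (hH0 : 0 < H) (hH1 : H < 1) {s t : ℝ}
    (hs : s ∈ Set.Icc (0 : ℝ) 1) (ht : t ∈ Set.Icc (0 : ℝ) 1) :
    |fbmCrossCov H s t| ≤ 16 * (s + t) ^ 2 := by
  have hp0 : 0 < 2 * H := by linarith
  have hp2 : 2 * H < 2 := by linarith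
  have h1 := abs_le.1 (abs_abs_one_sub_rpow_sub_le hp0 hp2 hs.1 (by linarith [hs.2]))
  have h2 := abs_le.1 (abs_abs_one_sub_rpow_sub_le hp0 hp2 ht.1 (by linarith [ht.2]))
  have h3 := abs_le.1 (abs_abs_one_sub_rpow_sub_le hp0 hp2 (add_nonneg hs.1 ht.1)
    (by linarith [hs.2, ht.2]))
  have hst := mul_nonneg hs.1 ht.1
  rw [abs_le, fbmCrossCov]
  constructor <;> nlinarith [h1.1, h1.2, h2.1, h2.2, h3.1, h3.2]

theorem continuous_abs_rpow {p : ℝ} (hp : 0 < p) : Continuous fun x : ℝ => |x| ^ p :=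
  continuous_abs.rpow_const fun _ => Or.inr hp.le

/-- `∫_0^y e^{-x} |x|^p dx`. -/
noncomputable def lowerGamma (p y : ℝ) : ℝ := ∫ x in (0 : ℝ)..y, Real.exp (-x) * |x| ^ p

/-- `∫_0^y e^x |x|^p dx`. -/
noncomputable def expMoment (p y : ℝ) : ℝ := ∫ x in (0 : ℝ)..y, Real.exp x * |x| ^ p

theorem hasDerivAt_lowerGamma {p : ℝ} (hp : 0 < p) (y : ℝ) :
    HasDerivAt (lowerGamma p) (Real.exp (-y) * |y| ^ p) y :=
  hasDerivAt_integral_of_continuous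
    ((by fun_prop : Continuous fun x : ℝ => Real.exp (-x)).mul (continuous_abs_rpow hp)) 0 y

theorem hasDerivAt_expMoment {p : ℝ} (hp : 0 < p) (y : ℝ) :
    HasDerivAt (expMoment p) (Real.exp y * |y| ^ p) y :=
  hasDerivAt_integral_of_continuous (Real.continuous_exp.mul (continuous_abs_rpow hp)) 0 y

theorem tendsto_lowerGamma {p : ℝ} (hp : 0 < p) :
    Tendsto (lowerGamma p) atTop (𝓝 (Real.Gamma (p + 1))) := by
  have hG := Real.GammaIntegral_convergent (s := p + 1) (by linarith)
  rw [Real.Gamma_eq_integral (by linarith)]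
  refine (intervalIntegral_tendsto_integral_Ioi 0 hG tendsto_id).congr' ?_
  filter_upwards [eventually_ge_atTop 0] with y hy
  refine intervalIntegral.integral_congr fun x hx => ?_
  rw [id, Set.uIcc_of_le hy] at hx
  simp [abs_of_nonneg hx.1]

theorem tendsto_exp_mul_expMoment {p : ℝ} (hp : 0 < p) :
    Tendsto (fun l => Real.exp (-2 * l) * expMoment p l) atTop (𝓝 0) := by
  refine squeeze_zero_norm' ?_ (tendsto_rpow_mul_mul_exp_neg (p + 1) 1)
  filter_upwards [eventually_gt_atTop 0] with l hl
  have hb := intervalIntegral.norm_integral_le_of_norm_le_const (a := 0) (b := l)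
    (f := fun x => Real.exp x * |x| ^ p) (C := Real.exp l * l ^ p) (fun x hx => by
      rw [Set.uIoc_of_le hl.le] at hx
      rw [Real.norm_eq_abs, abs_of_nonneg (by positivity), abs_of_pos hx.1]
      have := Real.rpow_le_rpow hx.1.le hx.2 hp.le
      have := Real.exp_le_exp.2 hx.2
      have := hx.1
      gcongr)
  rw [sub_zero, abs_of_pos hl] at hb
  rw [norm_mul, Real.norm_eq_abs, Real.abs_exp, one_mul, Real.rpow_add_one hl.ne']
  calc _ ≤ Real.exp (-2 * l) * (Real.exp l * l ^ p * l) := by gcongr; exact hb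
    _ = l ^ p * l * (Real.exp (-2 * l) * Real.exp l) := by ring
    _ = _ := by rw [← Real.exp_add]; ring_nf

/-- Split at `s = r` and substitute `x = r - s` and `x = s - r`. Oriented integrals make this valid
for `r` outside `[0, l]` too. -/
theorem integral_exp_mul_abs_sub_rpow {p : ℝ} (hp : 0 < p) (l r : ℝ) :
    ∫ s in (0 : ℝ)..l, Real.exp (-r - s) * |r - s| ^ p
      = Real.exp (-2 * r) * expMoment p r + Real.exp (-2 * r) * lowerGamma p (l - r) := by
  have hc : Continuous fun s => Real.exp (-r - s) * |r - s| ^ p :=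
    (by fun_prop : Continuous fun s : ℝ => Real.exp (-r - s)).mul
      ((continuous_abs_rpow hp).comp (continuous_const.sub continuous_id))
  rw [← intervalIntegral.integral_add_adjacent_intervals (hc.intervalIntegrable 0 r)
    (hc.intervalIntegrable r l)]
  congr 1
  · have := intervalIntegral.integral_comp_sub_left
      (fun x => Real.exp (-2 * r) * (Real.exp x * |x| ^ p)) r (a := 0) (b := r)
    rw [sub_self, sub_zero] at this
    rw [expMoment, ← intervalIntegral.integral_const_mul, ← this]
    refine intervalIntegral.integral_congr fun s _ => ?_
    simp only [← mul_assoc, ← Real.exp_add]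
    ring_nf
  · have := intervalIntegral.integral_comp_sub_right
      (fun x => Real.exp (-2 * r) * (Real.exp (-x) * |x| ^ p)) r (a := r) (b := l)
    rw [sub_self] at this
    rw [lowerGamma, ← intervalIntegral.integral_const_mul, ← this]
    refine intervalIntegral.integral_congr fun s _ => ?_
    simp only [← mul_assoc, ← Real.exp_add, abs_sub_comm r s]
    ring_nf

theorem hasDerivAt_exp_const_mul (c x : ℝ) :
    HasDerivAt (fun x : ℝ => Real.exp (c * x)) (c * Real.exp (c * x)) x := by
  have h : HasDerivAt (fun x : ℝ => c * x) c x := by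
    simpa using (hasDerivAt_id x).const_mul c
  simpa [mul_comm] using h.exp

theorem integral_integral_exp_mul_abs_sub_rpow {p : ℝ} (hp : 0 < p) (l : ℝ) :
    ∫ r in (0 : ℝ)..l, ∫ s in (0 : ℝ)..l, Real.exp (-r - s) * |r - s| ^ p
      = lowerGamma p l - Real.exp (-2 * l) * expMoment p l := by
  have hcg : Continuous (expMoment p) :=
    continuous_iff_continuousAt.2 fun x => (hasDerivAt_expMoment hp x).continuousAt
  have hch : Continuous (lowerGamma p) :=
    continuous_iff_continuousAt.2 fun x => (hasDerivAt_lowerGamma hp x).continuousAt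
  -- This antiderivative comes from integrating `e^{-2 r}` by parts; the second and fourth terms
  -- compensate the derivatives falling on `expMoment` and `lowerGamma`.
  have h1 : ∀ r, HasDerivAt (fun r => -(1 / 2) * (Real.exp (-2 * r) * expMoment p r)
      + 1 / 2 * lowerGamma p r - 1 / 2 * (Real.exp (-2 * r) * lowerGamma p (l - r))
      + 1 / 2 * Real.exp (-2 * l) * expMoment p (l - r))
      (Real.exp (-2 * r) * expMoment p r + Real.exp (-2 * r) * lowerGamma p (l - r)) r := by
    intro r
    have he := hasDerivAt_exp_const_mul (-2) r
    have hs := (hasDerivAt_id r).const_sub l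
    have hd := (((he.mul (hasDerivAt_expMoment hp r)).const_mul (-(1 / 2))).add
      ((hasDerivAt_lowerGamma hp r).const_mul (1 / 2))).sub
      ((he.mul ((hasDerivAt_lowerGamma hp (l - r)).comp r hs)).const_mul (1 / 2)) |>.add
      (((hasDerivAt_expMoment hp (l - r)).comp r hs).const_mul (1 / 2 * Real.exp (-2 * l)))
    convert! hd using 1
    have e1 : Real.exp (-2 * r) * Real.exp r = Real.exp (-r) := by
      rw [← Real.exp_add]; ring_nf
    have e2 : Real.exp (-2 * l) * Real.exp (l - r)
        = Real.exp (-2 * r) * Real.exp (-(l - r)) := by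
      rw [← Real.exp_add, ← Real.exp_add]; ring_nf
    simp only [Function.comp_apply]
    linear_combination (1 / 2 * |r| ^ p) * e1 + (1 / 2 * |l - r| ^ p) * e2
  have h2 := intervalIntegral.integral_eq_sub_of_hasDerivAt (a := 0) (b := l)
    (fun r _ => h1 r) (Continuous.intervalIntegrable (by fun_prop) _ _)
  rw [intervalIntegral.integral_congr (fun r _ => integral_exp_mul_abs_sub_rpow hp l r), h2]
  simp [lowerGamma, expMoment]
  ring

theorem integral_exp_neg (l : ℝ) : ∫ s in (0 : ℝ)..l, Real.exp (-s) = 1 - Real.exp (-l) := by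
  have := intervalIntegral.integral_comp_neg (fun x => Real.exp x) (a := 0) (b := l)
  simp [this]

theorem continuous_uncurry_fbmCov {H : ℝ} (hH : 0 < H) :
    Continuous (Function.uncurry (fbmCov H)) := by
  have hc := continuous_abs_rpow (p := 2 * H) (by linarith)
  unfold fbmCov Function.uncurry
  exact continuous_const.mul (((hc.comp continuous_fst).add (hc.comp continuous_snd)).sub
    (hc.comp (continuous_fst.sub continuous_snd)))

theorem continuous_uncurry_fbmCrossCov {H : ℝ} (hH : 0 < H) :
    Continuous (Function.uncurry (fbmCrossCov H)) := by
  have hc := continuous_abs_rpow (p := 2 * H) (by linarith)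
  unfold fbmCrossCov Function.uncurry
  exact continuous_const.mul (((continuous_const.sub
    (hc.comp (continuous_const.sub continuous_fst))).sub
    (hc.comp (continuous_const.sub continuous_snd))).add
    (hc.comp (continuous_const.sub (continuous_fst.add continuous_snd))))

theorem continuous_fbmCrossCov_comp {α : Type*} [TopologicalSpace α] {H : ℝ} (hH : 0 < H)
    {f g : α → ℝ} (hf : Continuous f) (hg : Continuous g) :
    Continuous fun x => fbmCrossCov H (f x) (g x) := by
  have h := (continuous_uncurry_fbmCrossCov hH).comp (hf.prodMk hg)
  simpa only [Function.comp_def, Function.uncurry_def] using h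

/-- Each of the three terms of the covariance contributes `Γ(2H+1)` in the limit, with signs `+`,
`+`, `-` and the common factor `1/2`. -/
theorem tendsto_integral_integral_fbmCov {H : ℝ} (hH : 0 < H) :
    Tendsto (fun l => ∫ r in (0 : ℝ)..l, ∫ s in (0 : ℝ)..l, Real.exp (-r - s) * fbmCov H r s)
      atTop (𝓝 (Real.Gamma (2 * H + 1) / 2)) := by
  have hp : 0 < 2 * H := by linarith
  have hc := continuous_abs_rpow hp
  have hexp : Tendsto (fun l : ℝ => 1 - Real.exp (-l)) atTop (𝓝 (1 - 0)) :=
    tendsto_const_nhds.sub (Real.tendsto_exp_atBot.comp tendsto_neg_atTop_atBot)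
  have hlim := (((tendsto_lowerGamma hp).mul hexp).sub
    (((tendsto_lowerGamma hp).sub (tendsto_exp_mul_expMoment hp)).const_mul (1 / 2)))
  have e : Real.Gamma (2 * H + 1) * (1 - 0) - 1 / 2 * (Real.Gamma (2 * H + 1) - 0)
      = Real.Gamma (2 * H + 1) / 2 := by ring
  rw [e] at hlim
  refine hlim.congr fun l => ?_
  have hD := integral_integral_exp_mul_abs_sub_rpow hp l
  have hcd : Continuous (Function.uncurry fun r s : ℝ => Real.exp (-r - s) * |r - s| ^ (2 * H)) :=
    (by fun_prop : Continuous fun q : ℝ × ℝ => Real.exp (-q.1 - q.2)).mul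
      (hc.comp (continuous_fst.sub continuous_snd))
  have hci : Continuous fun r => ∫ s in (0 : ℝ)..l, Real.exp (-r - s) * |r - s| ^ (2 * H) :=
    intervalIntegral.continuous_parametric_intervalIntegral_of_continuous' hcd 0 l
  have hinner : ∀ r, ∫ s in (0 : ℝ)..l, Real.exp (-r - s) * fbmCov H r s
      = 1 / 2 * ((Real.exp (-r) * |r| ^ (2 * H)) * (1 - Real.exp (-l))
        + Real.exp (-r) * lowerGamma (2 * H) l
        - ∫ s in (0 : ℝ)..l, Real.exp (-r - s) * |r - s| ^ (2 * H)) := by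
    intro r
    have hcr : Continuous fun s => Real.exp (-r - s) * |r - s| ^ (2 * H) :=
      hcd.comp (by fun_prop : Continuous fun s => (r, s))
    rw [← integral_exp_neg, lowerGamma, ← intervalIntegral.integral_const_mul,
      ← intervalIntegral.integral_const_mul, ← intervalIntegral.integral_add
      (Continuous.intervalIntegrable (by fun_prop) _ _)
      (Continuous.intervalIntegrable (by fun_prop) _ _), ← intervalIntegral.integral_sub
      (Continuous.intervalIntegrable (by fun_prop) _ _)
      (hcr.intervalIntegrable _ _),
      ← intervalIntegral.integral_const_mul]
    refine intervalIntegral.integral_congr fun s _ => ?_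
    simp only [fbmCov, sub_eq_add_neg (-r) s, Real.exp_add]
    ring
  simp_rw [hinner]
  rw [intervalIntegral.integral_const_mul, intervalIntegral.integral_sub
      (Continuous.intervalIntegrable (by fun_prop) _ _) (hci.intervalIntegrable _ _),
      intervalIntegral.integral_add
      (Continuous.intervalIntegrable (by fun_prop) _ _)
      (Continuous.intervalIntegrable (by fun_prop) _ _), hD,
      intervalIntegral.integral_mul_const, intervalIntegral.integral_mul_const, integral_exp_neg]
  simp only [lowerGamma]
  ring

/-- Half of the exponential absorbs the square: `x^2 / 8 ≤ e^{x/2}`. The other half remains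
integrable. -/
theorem sq_mul_exp_neg_le {x : ℝ} (hx : 0 ≤ x) :
    x ^ 2 * Real.exp (-x) ≤ 8 * Real.exp (-(1 / 2) * x) := by
  have h := Real.quadratic_le_exp_of_nonneg (x := x / 2) (by positivity)
  have e : Real.exp (-x) = Real.exp (-(1 / 2) * x) * Real.exp (-(1 / 2) * x) := by
    rw [← Real.exp_add]; ring_nf
  have e2 : Real.exp (x / 2) * Real.exp (-(1 / 2) * x) = 1 := by
    rw [← Real.exp_add]; ring_nf; exact Real.exp_zero
  have h3 : x ^ 2 ≤ 8 * Real.exp (x / 2) := by nlinarith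
  rw [e, ← mul_assoc]
  have := Real.exp_pos (-(1 / 2) * x)
  calc x ^ 2 * Real.exp (-(1 / 2) * x) * Real.exp (-(1 / 2) * x)
      ≤ 8 * Real.exp (x / 2) * Real.exp (-(1 / 2) * x) * Real.exp (-(1 / 2) * x) := by gcongr
    _ = _ := by rw [mul_assoc 8, e2]; ring

theorem integral_exp_neg_half_le {l : ℝ} :
    ∫ s in (0 : ℝ)..l, Real.exp (-(1 / 2) * s) ≤ 2 := by
  have h := intervalIntegral.integral_eq_sub_of_hasDerivAt (a := 0) (b := l)
    (f := fun s => -2 * Real.exp (-(1 / 2) * s)) (f' := fun s => Real.exp (-(1 / 2) * s))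
    (fun s _ => by
      convert! (hasDerivAt_exp_const_mul (-(1 / 2)) s).const_mul (-2) using 1
      ring) (Continuous.intervalIntegrable (by fun_prop) _ _)
  rw [h]
  simp
  positivity

/-- The quadratic bound at `(r/l, s/l)` yields a factor `l^{-2}` against the scaling `l^{2H}`. The
constant 512 is `16 · 8` times 2 for each of the two exponential integrals. -/
theorem tendsto_integral_integral_fbmCrossCov {H : ℝ} (hH0 : 0 < H) (hH1 : H < 1) :
    Tendsto (fun l => ∫ r in (0 : ℝ)..l, ∫ s in (0 : ℝ)..l,
      Real.exp (-r - s) * (l ^ (2 * H) * fbmCrossCov H (r / l) (s / l))) atTop (𝓝 0) := by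
  have hlim : Tendsto (fun l : ℝ => 512 * l ^ (-(2 - 2 * H))) atTop (𝓝 (512 * 0)) :=
    (tendsto_rpow_neg_atTop (by linarith : 0 < 2 - 2 * H)).const_mul 512
  rw [mul_zero] at hlim
  refine squeeze_zero_norm' ?_ hlim
  filter_upwards [eventually_gt_atTop 0] with l hl
  have hpow : l ^ (2 * H) = l ^ (-(2 - 2 * H)) * l ^ 2 := by
    rw [← Real.rpow_natCast, ← Real.rpow_add hl]; push_cast; ring_nf
  have hq : 0 < l ^ (-(2 - 2 * H)) := Real.rpow_pos_of_pos hl _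
  have hpt : ∀ r ∈ Set.Ioc 0 l, ∀ s ∈ Set.Ioc 0 l,
      |Real.exp (-r - s) * (l ^ (2 * H) * fbmCrossCov H (r / l) (s / l))|
      ≤ 128 * l ^ (-(2 - 2 * H)) * Real.exp (-(1 / 2) * r) * Real.exp (-(1 / 2) * s) := by
    intro r hr s hs
    have hm : ∀ x ∈ Set.Ioc 0 l, x / l ∈ Set.Icc (0 : ℝ) 1 := fun x hx =>
      ⟨div_nonneg hx.1.le hl.le, (div_le_one hl).2 hx.2⟩
    have h := abs_fbmCrossCov_le hH0 hH1 (hm r hr) (hm s hs)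
    have hx := sq_mul_exp_neg_le (add_pos hr.1 hs.1).le
    rw [abs_mul, abs_mul, Real.abs_exp, abs_of_pos (Real.rpow_pos_of_pos hl _)]
    calc _ ≤ Real.exp (-r - s) * (l ^ (2 * H) * (16 * (r / l + s / l) ^ 2)) := by gcongr
      _ = 16 * l ^ (-(2 - 2 * H)) * ((r + s) ^ 2 * Real.exp (-(r + s))) := by
        rw [hpow, neg_add']; field_simp
      _ ≤ 16 * l ^ (-(2 - 2 * H)) * (8 * Real.exp (-(1 / 2) * (r + s))) := by gcongr
      _ = _ := by rw [mul_add, Real.exp_add]; ring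
  have hc : Continuous fun x : ℝ => Real.exp (-(1 / 2) * x) := by fun_prop
  have hin : ∀ r ∈ Set.Ioc 0 l, ‖∫ s in (0 : ℝ)..l,
      Real.exp (-r - s) * (l ^ (2 * H) * fbmCrossCov H (r / l) (s / l))‖
      ≤ 256 * l ^ (-(2 - 2 * H)) * Real.exp (-(1 / 2) * r) := by
    intro r hr
    refine (intervalIntegral.norm_integral_le_of_norm_le hl.le
      (g := fun s => 128 * l ^ (-(2 - 2 * H)) * Real.exp (-(1 / 2) * r) * Real.exp (-(1 / 2) * s))
      (ae_of_all _ fun s hs => hpt r hr s hs)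
      (Continuous.intervalIntegrable (by fun_prop) _ _)).trans ?_
    rw [intervalIntegral.integral_const_mul]
    calc _ ≤ 128 * l ^ (-(2 - 2 * H)) * Real.exp (-(1 / 2) * r) * 2 := by
          gcongr; exact integral_exp_neg_half_le
      _ = _ := by ring
  refine (intervalIntegral.norm_integral_le_of_norm_le hl.le
      (g := fun r => 256 * l ^ (-(2 - 2 * H)) * Real.exp (-(1 / 2) * r))
      (ae_of_all _ fun r hr => hin r hr)
      (Continuous.intervalIntegrable (by fun_prop) _ _)).trans ?_
  rw [intervalIntegral.integral_const_mul]
  calc _ ≤ 256 * l ^ (-(2 - 2 * H)) * 2 := by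
        gcongr; exact integral_exp_neg_half_le
    _ = _ := by ring

end CovarianceAsymptotics

/-! ### Joint characteristic function of the two Laplace functionals. -/

section LaplaceFunctionals

theorem laplaceAt_one_eq (b : ℝ → ℝ) {l : ℝ} (hl : 0 < l) :
    laplaceAt l b 1 = ∫ r in (0 : ℝ)..l, Real.exp (-r) * b (r / l) := by
  have := intervalIntegral.mul_integral_comp_mul_left (a := 0) (b := 1)
    (f := fun r => Real.exp (-r) * b (r / l)) l
  rw [mul_zero, mul_one] at this
  rw [← this, laplaceAt]
  congr 1
  refine intervalIntegral.integral_congr fun s _ => ?_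
  simp only [mul_div_cancel_left₀ _ hl.ne', neg_mul]

theorem endpointLaplace_eq_integral (b : ℝ → ℝ) {l : ℝ} (hl : 0 < l) :
    endpointLaplace l b = ∫ r in (0 : ℝ)..l, Real.exp (-r) * (b 1 - b (1 - r / l)) := by
  have h1 := intervalIntegral.mul_integral_comp_mul_left (a := 0) (b := 1)
    (f := fun r => Real.exp (-r) * (b 1 - b (1 - r / l))) l
  have h2 := intervalIntegral.integral_comp_sub_left (a := 0) (b := 1)
    (fun s => Real.exp (-(l * s)) * (b 1 - b (1 - l * s / l))) 1
  rw [mul_zero, mul_one] at h1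
  rw [sub_self, sub_zero] at h2
  rw [← h1, ← h2, endpointLaplace]
  congr 1
  refine intervalIntegral.integral_congr fun s _ => ?_
  simp only [mul_div_cancel_left₀ _ hl.ne', neg_mul, sub_sub_cancel]

theorem integral_integral_linear_combination {K₁ K₂ : ℝ → ℝ → ℝ}
    (h₁ : Continuous (Function.uncurry K₁)) (h₂ : Continuous (Function.uncurry K₂)) (a c l : ℝ) :
    (∫ r in (0 : ℝ)..l, ∫ s in (0 : ℝ)..l, (a * K₁ r s + c * K₂ r s))
      = a * (∫ r in (0 : ℝ)..l, ∫ s in (0 : ℝ)..l, K₁ r s)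
        + c * ∫ r in (0 : ℝ)..l, ∫ s in (0 : ℝ)..l, K₂ r s := by
  have h₁r : ∀ r, Continuous (K₁ r) := fun r =>
    h₁.comp (by fun_prop : Continuous fun s => (r, s))
  have h₂r : ∀ r, Continuous (K₂ r) := fun r =>
    h₂.comp (by fun_prop : Continuous fun s => (r, s))
  have hi₁ := intervalIntegral.continuous_parametric_intervalIntegral_of_continuous' h₁ 0 l
    (μ := volume)
  have hi₂ := intervalIntegral.continuous_parametric_intervalIntegral_of_continuous' h₂ 0 l
    (μ := volume)
  have hin : ∀ r, ∫ s in (0 : ℝ)..l, (a * K₁ r s + c * K₂ r s)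
      = a * (∫ s in (0 : ℝ)..l, K₁ r s) + c * ∫ s in (0 : ℝ)..l, K₂ r s := fun r => by
    rw [intervalIntegral.integral_add (((h₁r r).intervalIntegrable _ _).const_mul a)
      (((h₂r r).intervalIntegrable _ _).const_mul c),
      intervalIntegral.integral_const_mul, intervalIntegral.integral_const_mul]
  simp_rw [hin]
  rw [intervalIntegral.integral_add ((hi₁.intervalIntegrable _ _).const_mul a)
    ((hi₂.intervalIntegrable _ _).const_mul c),
    intervalIntegral.integral_const_mul, intervalIntegral.integral_const_mul]

variable {Ω : Type*} [MeasurableSpace Ω] {P : Measure Ω} {H : ℝ} {B : ℝ → Ω → ℝ}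

namespace IsFractionalBrownianMotion

theorem ae_continuous (hB : IsFractionalBrownianMotion H B P) (hH : 0 < H) :
    ∀ᵐ ω ∂P, Continuous fun t => B t ω := by
  filter_upwards [hB.locallyHolder] with ω hω
  -- Any exponent in `(0, H)` would do.
  have hα : (0 : ℝ) < H / 2 := by positivity
  rw [continuous_iff_continuousAt]
  intro t
  obtain ⟨C, hC⟩ := hω ⟨H / 2, hα.le⟩ hα (by change H / 2 < H; linarith) (|t| + 1)
  refine (hC.continuousOn hα).continuousAt (Icc_mem_nhds ?_ ?_)
  · linarith [neg_abs_le t]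
  · linarith [le_abs_self t]

theorem integral_mul_eq (hB : IsFractionalBrownianMotion H B P) (s t : ℝ) :
    ∫ ω, B s ω * B t ω ∂P = fbmCov H s t := by
  rw [hB.covariance, fbmCov]

theorem memLp_two (hB : IsFractionalBrownianMotion H B P) (t : ℝ) : MemLp (B t) 2 P :=
  (hB.isGaussianProcess.hasGaussianLaw_eval t).memLp_two

theorem ae_apply_zero (hB : IsFractionalBrownianMotion H B P) (hH : 0 < H) :
    ∀ᵐ ω ∂P, B 0 ω = 0 := by
  have h := hB.integral_mul_eq 0 0
  have hz : fbmCov H 0 0 = 0 := by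
    simp [fbmCov, Real.zero_rpow (by linarith : (2 * H) ≠ 0)]
  rw [hz, integral_eq_zero_iff_of_nonneg (fun ω => mul_self_nonneg _)
    ((hB.memLp_two 0).integrable_mul (hB.memLp_two 0))] at h
  filter_upwards [h] with ω hω
  simpa using hω

theorem ae_apply_one_ne_zero (hB : IsFractionalBrownianMotion H B P) (hH : 0 < H) :
    ∀ᵐ ω ∂P, B 1 ω ≠ 0 := by
  have hG := hB.isGaussianProcess.hasGaussianLaw_eval 1
  have h := hB.integral_mul_eq 1 1
  have hz : fbmCov H 1 1 = 1 := by
    simp [fbmCov, Real.zero_rpow (by linarith : (2 * H) ≠ 0)]; norm_num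
  have hvar : Var[B 1; P] = 1 := by
    rw [variance_of_integral_eq_zero hG.aemeasurable (hB.centered 1)]
    refine Eq.trans ?_ (h.trans hz)
    simp only [sq]
  have hmap := hG.map_eq_gaussianReal
  rw [hvar, hB.centered 1, Real.toNNReal_one] at hmap
  have hn := nullSingletonClass_gaussianReal (μ := 0) (v := 1) one_ne_zero
  have h0 : P.map (B 1) {0} = 0 := by rw [hmap]; exact measure_singleton 0
  rw [Measure.map_apply_of_aemeasurable hG.aemeasurable (measurableSet_singleton 0)] at h0
  exact measure_mono_null (fun ω hω => not_not.1 hω) h0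

/-- By stationarity of increments the reversed process `B_1 - B_{1-u}` has the same covariance as
`B`, whence the common coefficient `a^2 + c^2`; the mixed covariance is symmetric in `u` and `v`. -/
theorem integral_combination_mul (hB : IsFractionalBrownianMotion H B P) (hH : 0 < H)
    (a c u v : ℝ) :
    ∫ ω, (a * B u ω + c * (B 1 ω - B (1 - u) ω)) * (a * B v ω + c * (B 1 ω - B (1 - v) ω)) ∂P
      = (a ^ 2 + c ^ 2) * fbmCov H u v + 2 * (a * c) * fbmCrossCov H u v := by
  have hi : ∀ s t, Integrable (fun ω => B s ω * B t ω) P := fun s t =>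
    (hB.memLp_two s).integrable_mul (hB.memLp_two t)
  have hexp : ∀ ω, (a * B u ω + c * (B 1 ω - B (1 - u) ω))
        * (a * B v ω + c * (B 1 ω - B (1 - v) ω))
      = a ^ 2 * (B u ω * B v ω) + a * c * (B u ω * B 1 ω) - a * c * (B u ω * B (1 - v) ω)
        + a * c * (B 1 ω * B v ω) - a * c * (B (1 - u) ω * B v ω)
        + c ^ 2 * (B 1 ω * B 1 ω) - c ^ 2 * (B 1 ω * B (1 - v) ω)
        - c ^ 2 * (B (1 - u) ω * B 1 ω) + c ^ 2 * (B (1 - u) ω * B (1 - v) ω) := by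
    intro ω; ring
  simp_rw [hexp]
  have hk : ∀ k s t, Integrable (fun ω => k * (B s ω * B t ω)) P := fun k s t =>
    (hi s t).const_mul k
  rw [integral_add, integral_sub, integral_sub, integral_add, integral_sub, integral_add,
    integral_sub, integral_add]
  · simp only [integral_const_mul, hB.integral_mul_eq, fbmCov, fbmCrossCov]
    have hz : |(0 : ℝ)| ^ (2 * H) = 0 := by
      rw [abs_zero, Real.zero_rpow (by linarith)]
    have e1 : |u - 1| = |1 - u| := abs_sub_comm _ _
    have e2 : |u - (1 - v)| = |1 - (u + v)| := by rw [abs_sub_comm]; congr 1; ring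
    have e3 : |1 - u - v| = |1 - (u + v)| := by congr 1; ring
    have e4 : |1 - (1 - v)| = |v| := by congr 1; ring
    have e5 : |1 - u - 1| = |u| := by rw [← abs_neg]; congr 1; ring
    have e6 : |1 - u - (1 - v)| = |u - v| := by rw [abs_sub_comm]; congr 1; ring
    simp only [e1, e2, e3, e4, e5, e6, sub_self, hz, abs_one, Real.one_rpow]
    ring
  all_goals fun_prop

theorem fbmCov_div {l : ℝ} (hl : 0 < l) (r s : ℝ) :
    l ^ (2 * H) * fbmCov H (r / l) (s / l) = fbmCov H r s := by
  have h : ∀ x : ℝ, l ^ (2 * H) * |x / l| ^ (2 * H) = |x| ^ (2 * H) := fun x => by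
    rw [← Real.mul_rpow hl.le (abs_nonneg _), abs_div, abs_of_pos hl]
    congr 1
    field_simp
  simp only [fbmCov, ← sub_div]
  rw [← h r, ← h s, ← h (r - s)]
  ring

/-- The characteristic function of the pair of scaled Laplace functionals. -/
theorem integral_exp_combination (hB : IsFractionalBrownianMotion H B P) (hH : 0 < H)
    {l : ℝ} (hl : 0 < l) (a c : ℝ) :
    ∫ ω, Complex.exp (((a * (l ^ H * laplaceAt l (fun t => B t ω) 1)
        + c * (l ^ H * endpointLaplace l fun t => B t ω) : ℝ) : ℂ) * Complex.I) ∂P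
      = Complex.exp (-(((a ^ 2 + c ^ 2)
          * (∫ r in (0 : ℝ)..l, ∫ s in (0 : ℝ)..l, Real.exp (-r - s) * fbmCov H r s)
          + 2 * (a * c) * (∫ r in (0 : ℝ)..l, ∫ s in (0 : ℝ)..l,
            Real.exp (-r - s) * (l ^ (2 * H) * fbmCrossCov H (r / l) (s / l))) : ℝ) : ℂ) / 2) := by
  classical
  -- After the substitution `r = l s`, the linear combination of functionals is the integral of this
  -- Gaussian process over `[0, l]`. The factor `l^H` makes its diagonal covariance part independent
  -- of `l` by self-similarity.
  set G : ℝ → Ω → ℝ := fun r ω => l ^ H * Real.exp (-r)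
    * (a * B (r / l) ω + c * (B 1 ω - B (1 - r / l) ω)) with hGdef
  have hG : IsGaussianProcess G P := hB.isGaussianProcess.of_isGaussianProcess fun r =>
    ⟨{r / l, 1, 1 - r / l},
      (l ^ H * Real.exp (-r)) • (a • ContinuousLinearMap.proj ⟨r / l, by simp⟩
        + c • (ContinuousLinearMap.proj ⟨1, by simp⟩
          - ContinuousLinearMap.proj ⟨1 - r / l, by simp⟩)), fun ω => by simp [hGdef, mul_add]⟩
  have hi : ∀ t, Integrable (B t) P := fun t =>
    (hB.isGaussianProcess.hasGaussianLaw_eval t).integrable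
  have hmean : ∀ r, ∫ ω, G r ω ∂P = 0 := fun r => by
    simp only [hGdef]
    have h2 : Integrable (fun ω => B 1 ω - B (1 - r / l) ω) P := (hi _).sub (hi _)
    rw [integral_const_mul, integral_add ((hi _).const_mul _) (h2.const_mul _),
      integral_const_mul, integral_const_mul, integral_sub (hi _) (hi _)]
    simp [hB.centered]
  have hcont : ∀ᵐ ω ∂P, Continuous fun r => G r ω := by
    filter_upwards [hB.ae_continuous hH] with ω hω
    have h1 : Continuous fun r => B (r / l) ω := hω.comp (by fun_prop)
    have h2 : Continuous fun r => B (1 - r / l) ω := hω.comp (by fun_prop)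
    simp only [hGdef]
    fun_prop
  set K1 : ℝ → ℝ → ℝ := fun r s => Real.exp (-r - s) * fbmCov H r s with hK1
  set K2 : ℝ → ℝ → ℝ := fun r s =>
    Real.exp (-r - s) * (l ^ (2 * H) * fbmCrossCov H (r / l) (s / l)) with hK2
  have hexp : Continuous fun q : ℝ × ℝ => Real.exp (-q.1 - q.2) := by fun_prop
  have hcK1 : Continuous (Function.uncurry K1) := hexp.mul (continuous_uncurry_fbmCov hH)
  have hcross : Continuous fun q : ℝ × ℝ => fbmCrossCov H (q.1 / l) (q.2 / l) :=
    continuous_fbmCrossCov_comp hH (by fun_prop) (by fun_prop)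
  have hcK2 : Continuous (Function.uncurry K2) := by
    simp only [hK2, Function.uncurry_def]
    fun_prop
  have hcov : ∀ r s, ∫ ω, G r ω * G s ω ∂P
      = (a ^ 2 + c ^ 2) * K1 r s + 2 * (a * c) * K2 r s := by
    intro r s
    have e : ∀ ω, G r ω * G s ω = l ^ (2 * H) * Real.exp (-r - s)
        * ((a * B (r / l) ω + c * (B 1 ω - B (1 - r / l) ω))
          * (a * B (s / l) ω + c * (B 1 ω - B (1 - s / l) ω))) := fun ω => by
      have e1 : l ^ (2 * H) = l ^ H * l ^ H := by rw [← Real.rpow_add hl]; ring_nf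
      simp only [hGdef, e1, sub_eq_add_neg (-r) s, Real.exp_add]
      ring
    simp_rw [e]
    rw [integral_const_mul, hB.integral_combination_mul hH]
    simp only [hK1, hK2, ← fbmCov_div hl r s]
    ring
  have hK : Continuous (Function.uncurry fun r s =>
      (a ^ 2 + c ^ 2) * K1 r s + 2 * (a * c) * K2 r s) := by
    simp only [Function.uncurry_def] at hcK1 hcK2 ⊢
    fun_prop
  have key := hG.integral_exp_intervalIntegral hmean hcont hK hcov hl.le
  rw [integral_integral_linear_combination hcK1 hcK2] at key
  rw [← key]
  refine integral_congr_ae ?_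
  filter_upwards [hB.ae_continuous hH] with ω hω
  have h1 : Continuous fun r => B (r / l) ω := hω.comp (by fun_prop)
  have h2 : Continuous fun r => B (1 - r / l) ω := hω.comp (by fun_prop)
  congr 3
  rw [laplaceAt_one_eq _ hl, endpointLaplace_eq_integral _ hl]
  simp only [← mul_assoc]
  rw [← intervalIntegral.integral_const_mul, ← intervalIntegral.integral_const_mul,
    ← intervalIntegral.integral_add (Continuous.intervalIntegrable (by fun_prop) _ _)
      (Continuous.intervalIntegrable (by fun_prop) _ _)]
  refine intervalIntegral.integral_congr fun r _ => ?_
  simp only [hGdef]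
  ring

theorem tendsto_integral_exp_combination (hB : IsFractionalBrownianMotion H B P) (hH0 : 0 < H)
    (hH1 : H < 1) (a c : ℝ) :
    Tendsto (fun l : ℝ => ∫ ω, Complex.exp (((a * (l ^ H * laplaceAt l (fun t => B t ω) 1)
        + c * (l ^ H * endpointLaplace l fun t => B t ω) : ℝ) : ℂ) * Complex.I) ∂P) atTop
      (𝓝 (Complex.exp (-(((a ^ 2 + c ^ 2) * (Real.Gamma (2 * H + 1) / 2) : ℝ) : ℂ) / 2))) := by
  have h := ((tendsto_integral_integral_fbmCov hH0).const_mul (a ^ 2 + c ^ 2)).add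
    ((tendsto_integral_integral_fbmCrossCov hH0 hH1).const_mul (2 * (a * c)))
  rw [mul_zero, add_zero] at h
  have h2 := (Continuous.tendsto (f := fun x : ℝ => Complex.exp (-(x : ℂ) / 2))
        (by fun_prop) _).comp h
  refine h2.congr' ?_
  filter_upwards [eventually_gt_atTop 0] with l hl
  rw [hB.integral_exp_combination hH0 hl]
  rfl

end IsFractionalBrownianMotion

end LaplaceFunctionals

/-! ### The Cauchy quotient, continuous mapping, and convergence through characteristic functions.
-/

section ConvergenceInDistribution

theorem integral_abs_mul_exp_neg_mul_sq {b : ℝ} (hb : 0 < b) :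
    ∫ z : ℝ, |z| * Real.exp (-b * z ^ 2) = b⁻¹ := by
  have h1 := integral_comp_abs (f := fun z : ℝ => z * Real.exp (-b * z ^ 2))
  simp only [sq_abs] at h1
  have h2 := integral_rpow_mul_exp_neg_mul_rpow (p := 2) (q := 1) two_pos (by norm_num) hb
  have e : (1 + 1 : ℝ) / 2 = 1 := by norm_num
  simp only [Real.rpow_one, Real.rpow_two, neg_div, e, Real.Gamma_one, mul_one,
    Real.rpow_neg_one] at h2
  rw [h1, h2]
  ring

theorem lintegral_abs_mul_exp_neg_mul_sq {b c : ℝ} (hb : 0 < b) (hc : 0 ≤ c) :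
    ∫⁻ z : ℝ, ENNReal.ofReal (c * (|z| * Real.exp (-b * z ^ 2))) = ENNReal.ofReal (c * b⁻¹) := by
  have hi : Integrable fun z : ℝ => |z| * Real.exp (-b * z ^ 2) := by
    have := (integrable_mul_exp_neg_mul_sq hb).norm
    simpa [abs_mul] using this
  rw [← integral_abs_mul_exp_neg_mul_sq hb, ← integral_const_mul,
    ofReal_integral_eq_lintegral_ofReal (hi.const_mul c) (ae_of_all _ fun z => by positivity)]

theorem gaussianPDF_mul_gaussianPDF_div {z : ℝ} (hz : z ≠ 0) (x : ℝ) :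
    gaussianPDF 0 1 z * gaussianPDF 0 (1 / .mk (z ^ 2) (sq_nonneg _)) x
      = ENNReal.ofReal ((2 * Real.pi)⁻¹ * (|z| * Real.exp (-((1 + x ^ 2) / 2) * z ^ 2))) := by
  rw [gaussianPDF, gaussianPDF, ← ENNReal.ofReal_mul (gaussianPDFReal_nonneg _ _ _)]
  congr 1
  simp only [gaussianPDFReal, sub_zero, NNReal.coe_one, mul_one, NNReal.coe_div, NNReal.coe_mk]
  have hz2 : 0 < z ^ 2 := by positivity
  have e1 : √(2 * Real.pi * (1 / z ^ 2)) = √(2 * Real.pi) / |z| := by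
    rw [mul_one_div, Real.sqrt_div (by positivity), Real.sqrt_sq_eq_abs]
  have e2 : (2 * Real.pi)⁻¹ = (√(2 * Real.pi))⁻¹ * (√(2 * Real.pi))⁻¹ := by
    rw [← mul_inv, Real.mul_self_sqrt (by positivity)]
  have e3 : Real.exp (-((1 + x ^ 2) / 2) * z ^ 2)
      = Real.exp (-z ^ 2 / 2) * Real.exp (-x ^ 2 / (2 * (1 / z ^ 2))) := by
    rw [← Real.exp_add]
    congr 1
    field_simp
    ring
  rw [e1, e2, e3, inv_div]
  ring

/-- The quotient of two independent standard normal variables is standard Cauchy. -/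
theorem map_div_gaussianReal_prod :
    ((gaussianReal 0 1).prod (gaussianReal 0 1)).map (fun q : ℝ × ℝ => q.1 / q.2)
      = cauchyMeasure 0 1 := by
  ext s hs
  have hm : Measurable fun q : ℝ × ℝ => q.1 / q.2 := by fun_prop
  have hk : Measurable fun q : ℝ × ℝ => ENNReal.ofReal
      ((2 * Real.pi)⁻¹ * (|q.1| * Real.exp (-((1 + q.2 ^ 2) / 2) * q.1 ^ 2))) := by fun_prop
  have hν : gaussianReal 0 1 = volume.withDensity (gaussianPDF 0 1) :=
    gaussianReal_of_var_ne_zero 0 one_ne_zero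
  have hslice : Measurable fun z : ℝ =>
      gaussianReal 0 1 ((fun y => (y, z)) ⁻¹' ((fun q : ℝ × ℝ => q.1 / q.2) ⁻¹' s)) :=
    measurable_measure_prodMk_right (hm hs)
  have hdens := lintegral_withDensity_eq_lintegral_mul volume (measurable_gaussianPDF 0 1) hslice
  rw [← hν] at hdens
  rw [Measure.map_apply hm hs, Measure.prod_apply_symm (hm hs), hdens]
  have hz0 : ∀ᵐ z : ℝ, z ≠ 0 := by simp [ae_iff]
  -- For a fixed denominator `z ≠ 0` the quotient is normal with variance `1 / z^2`. Tonelli then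
  -- leaves a Gaussian moment in `z` with rate `(1 + x^2) / 2`, which gives the Cauchy density.
  calc ∫⁻ z, (gaussianPDF 0 1 * fun z : ℝ =>
        gaussianReal 0 1 ((fun y => (y, z)) ⁻¹' ((fun q : ℝ × ℝ => q.1 / q.2) ⁻¹' s))) z
      = ∫⁻ z, ∫⁻ x in s, ENNReal.ofReal
          ((2 * Real.pi)⁻¹ * (|z| * Real.exp (-((1 + x ^ 2) / 2) * z ^ 2))) := by
        refine lintegral_congr_ae ?_
        filter_upwards [hz0] with z hz
        have hv : (1 / .mk (z ^ 2) (sq_nonneg _) : NNReal) ≠ 0 := by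
          rw [one_div]
          refine inv_ne_zero fun h => hz ?_
          have := congrArg NNReal.toReal h
          simpa using this
        have hmap : gaussianReal 0 1 ((fun y => (y, z)) ⁻¹' ((fun q : ℝ × ℝ => q.1 / q.2) ⁻¹' s))
            = ∫⁻ x in s, gaussianPDF 0 (1 / .mk (z ^ 2) (sq_nonneg _)) x := by
          have := gaussianReal_map_div_const (μ := 0) (v := 1) z
          rw [zero_div] at this
          rw [← gaussianReal_apply 0 hv, ← this, Measure.map_apply (by fun_prop) hs]
          rfl
        rw [Pi.mul_apply, hmap, ← lintegral_const_mul _ (measurable_gaussianPDF _ _)]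
        refine lintegral_congr fun x => ?_
        exact gaussianPDF_mul_gaussianPDF_div hz x
    _ = ∫⁻ x in s, ∫⁻ z, ENNReal.ofReal
          ((2 * Real.pi)⁻¹ * (|z| * Real.exp (-((1 + x ^ 2) / 2) * z ^ 2))) :=
        lintegral_lintegral_swap hk.aemeasurable
    _ = ∫⁻ x in s, cauchyPDF 0 1 x := by
        refine lintegral_congr fun x => ?_
        rw [lintegral_abs_mul_exp_neg_mul_sq (by positivity) (by positivity), cauchyPDF,
          cauchyPDFReal]
        congr 1
        have : 1 + x ^ 2 ≠ 0 := by positivity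
        simp only [sub_zero, NNReal.coe_one, one_pow, mul_one]
        rw [add_comm (x ^ 2)]
        field_simp
    _ = cauchyMeasure 0 1 s := by
        rw [cauchyMeasure, if_neg one_ne_zero, withDensity_apply _ hs]

/-- Continuous mapping by the open-set form of the portmanteau theorem: for open `G` the set `O ∩ g
⁻¹' G` is open, and intersecting with `O` costs no mass in the limit law. The approximating
variables need not lie in `O`. -/
theorem tendstoInDistribution_comp_of_continuousOn {ι Ω Ω' E F : Type*} [MeasurableSpace Ω]
    [MeasurableSpace Ω'] {P : Measure Ω} [IsProbabilityMeasure P] {P' : Measure Ω'}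
    [IsProbabilityMeasure P'] [TopologicalSpace E] [MeasurableSpace E] [BorelSpace E]
    [HasOuterApproxClosed E] [TopologicalSpace F] [MeasurableSpace F] [BorelSpace F]
    {l : Filter ι} [l.IsCountablyGenerated] {X : ι → Ω → E} {Z : Ω' → E} {g : E → F} {O : Set E}
    (hO : IsOpen O) (hg : ContinuousOn g O) (hgm : Measurable g) (hZ : ∀ᵐ ω ∂P', Z ω ∈ O)
    (h : TendstoInDistribution X l Z (fun _ => P) P') :
    TendstoInDistribution (fun i ω => g (X i ω)) l (fun ω => g (Z ω)) (fun _ => P) P' where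
  forall_aemeasurable i := hgm.comp_aemeasurable (h.forall_aemeasurable i)
  aemeasurable_limit := hgm.comp_aemeasurable h.aemeasurable_limit
  tendsto := by
    refine tendsto_of_forall_isOpen_le_liminf' fun G hG => ?_
    have hU : IsOpen (O ∩ g ⁻¹' G) := hg.isOpen_inter_preimage hO hG
    have hle := ProbabilityMeasure.le_liminf_measure_open_of_tendsto h.tendsto hU
    simp only [ProbabilityMeasure.coe_mk] at hle ⊢
    have hgX : ∀ i, AEMeasurable (fun ω => g (X i ω)) P := fun i =>
      hgm.comp_aemeasurable (h.forall_aemeasurable i)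
    have hgZ : AEMeasurable (fun ω => g (Z ω)) P' := hgm.comp_aemeasurable h.aemeasurable_limit
    calc P'.map (fun ω => g (Z ω)) G ≤ P'.map Z (O ∩ g ⁻¹' G) := by
          rw [Measure.map_apply_of_aemeasurable hgZ
            hG.measurableSet, Measure.map_apply_of_aemeasurable h.aemeasurable_limit
            hU.measurableSet]
          refine measure_mono_ae ?_
          filter_upwards [hZ] with ω hω hGω
          exact ⟨hω, hGω⟩
      _ ≤ liminf (fun i => P.map (X i) (O ∩ g ⁻¹' G)) l := hle
      _ ≤ liminf (fun i => P.map (fun ω => g (X i ω)) G) l := by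
          refine liminf_le_liminf (Eventually.of_forall fun i => ?_)
          rw [Measure.map_apply_of_aemeasurable (hgX i) hG.measurableSet,
            Measure.map_apply_of_aemeasurable (h.forall_aemeasurable i) hU.measurableSet]
          exact measure_mono fun ω hω => hω.2

/-- Lévy's continuity theorem needs an inner product, so it is applied in `WithLp 2 (ℝ × ℝ)` and
transported back along the continuous map `WithLp.ofLp`. -/
theorem tendstoInDistribution_prodMk_of_charFun {Ω Ω' : Type*} [MeasurableSpace Ω]
    [MeasurableSpace Ω'] {P : Measure Ω} [IsProbabilityMeasure P] {P' : Measure Ω'}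
    [IsProbabilityMeasure P'] {X Y : ℕ → Ω → ℝ} {S T : Ω' → ℝ}
    (hX : ∀ n, AEMeasurable (X n) P) (hY : ∀ n, AEMeasurable (Y n) P)
    (hS : AEMeasurable S P') (hT : AEMeasurable T P')
    (h : ∀ a c : ℝ, Tendsto (fun n => ∫ ω, Complex.exp
        (((a * X n ω + c * Y n ω : ℝ) : ℂ) * Complex.I) ∂P) atTop
      (𝓝 (∫ ω, Complex.exp (((a * S ω + c * T ω : ℝ) : ℂ) * Complex.I) ∂P'))) :
    TendstoInDistribution (fun n ω => (X n ω, Y n ω)) atTop (fun ω => (S ω, T ω))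
      (fun _ => P) P' := by
  have hXY : ∀ n, AEMeasurable (fun ω => WithLp.toLp 2 (X n ω, Y n ω)) P := fun n => by
    have := hX n; have := hY n; fun_prop
  have hST : AEMeasurable (fun ω => WithLp.toLp 2 (S ω, T ω)) P' := by fun_prop
  have key : TendstoInDistribution (fun n ω => WithLp.toLp 2 (X n ω, Y n ω)) atTop
      (fun ω => WithLp.toLp 2 (S ω, T ω)) (fun _ => P) P' :=
    { forall_aemeasurable := hXY
      aemeasurable_limit := hST
      tendsto := by
        refine ProbabilityMeasure.tendsto_of_tendsto_charFun fun t => ?_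
        have e : ∀ x y : ℝ, inner ℝ (WithLp.toLp 2 (x, y)) t = t.fst * x + t.snd * y := by
          intro x y; simp [WithLp.prod_inner_apply]
        simp only [ProbabilityMeasure.coe_mk, charFun_apply]
        rw [integral_map hST (by fun_prop)]
        simp_rw [fun n => integral_map (hXY n) (f := fun x => Complex.exp ((inner ℝ x t : ℝ) * Complex.I))
          (by fun_prop), e]
        exact h t.fst t.snd }
  exact key.continuous_comp (g := WithLp.ofLp) (by fun_prop)

theorem integral_exp_gaussian_combination {Ω' : Type*} [MeasurableSpace Ω'] {P' : Measure Ω'}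
    {Y Z : Ω' → ℝ}
    (hYZ : HasLaw (fun ω => (Y ω, Z ω)) ((gaussianReal 0 1).prod (gaussianReal 0 1)) P')
    (a c : ℝ) :
    ∫ ω, Complex.exp (((a * Z ω + c * Y ω : ℝ) : ℂ) * Complex.I) ∂P'
      = Complex.exp (-((a ^ 2 + c ^ 2 : ℝ) : ℂ) / 2) := by
  have hφ : ∀ t : ℝ, ∫ x : ℝ, Complex.exp (t * x * Complex.I) ∂gaussianReal 0 1
      = Complex.exp (-(t : ℂ) ^ 2 / 2) := fun t => by
    rw [← charFun_apply_real, charFun_gaussianReal]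
    simp [neg_div]
  have h := integral_map hYZ.aemeasurable (f := fun q : ℝ × ℝ =>
    Complex.exp (((a * q.2 + c * q.1 : ℝ) : ℂ) * Complex.I)) (by fun_prop)
  rw [← h, hYZ.map_eq]
  have e : ∀ q : ℝ × ℝ, Complex.exp (((a * q.2 + c * q.1 : ℝ) : ℂ) * Complex.I)
      = Complex.exp (c * q.1 * Complex.I) * Complex.exp (a * q.2 * Complex.I) := fun q => by
    rw [← Complex.exp_add]; push_cast; ring_nf
  simp_rw [e]
  rw [integral_prod_mul (fun y : ℝ => Complex.exp (c * y * Complex.I))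
    (fun z : ℝ => Complex.exp (a * z * Complex.I)), hφ, hφ, ← Complex.exp_add]
  push_cast
  ring_nf

end ConvergenceInDistribution

/-! ### The scaled statistic as a function of energy and numerator, and its limit. -/

section Explosive

/-- The map that produces the scaled vector from the scaled energy and numerator. -/
noncomputable def explosiveMap (q : ℝ × ℝ) : Fin 4 → ℝ :=
  ![(q.1 / 2) ^ (-(1 / 2) : ℝ), (q.1 / 2)⁻¹, q.2 * (q.1 / 2) ^ (-(1 / 2) : ℝ),
    q.2 * (q.1 / 2)⁻¹]

theorem measurable_explosiveMap : Measurable explosiveMap := by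
  rw [measurable_pi_iff]
  intro i
  fin_cases i <;> simp only [explosiveMap] <;> dsimp <;> fun_prop

theorem continuousOn_explosiveMap : ContinuousOn explosiveMap {q | 0 < q.1} := by
  have h1 : ContinuousOn (fun q : ℝ × ℝ => q.1 / 2) {q | 0 < q.1} := by fun_prop
  have hpos : ∀ q ∈ {q : ℝ × ℝ | 0 < q.1}, q.1 / 2 ≠ 0 := fun q hq => (half_pos hq).ne'
  have h2 := h1.rpow_const (p := -(1 / 2)) fun q hq => Or.inl (hpos q hq)
  have h3 := h1.inv₀ hpos
  rw [continuousOn_pi]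
  intro i
  fin_cases i
  · exact h2
  · exact h3
  · exact continuous_snd.continuousOn.mul h2
  · exact continuous_snd.continuousOn.mul h3

theorem explosiveScaling_mulVec_tau {H l : ℝ} (hl : 0 < l) {b : ℝ → ℝ}
    (hJ : 0 < fOUEnergy (-l) b) :
    (explosiveScaling H (-l)).mulVec (tau (-l) b)
      = explosiveMap (l ^ (2 * H) * (2 * l * Real.exp (-2 * l) * fOUEnergy (-l) b),
          l ^ (2 * H) * (Real.exp (-l) * (fOU (-l) b 1 ^ 2 / 2 + -l * fOUEnergy (-l) b))) := by
  set J := fOUEnergy (-l) b with hJdef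
  set N := fOU (-l) b 1 ^ 2 / 2 + -l * J with hN
  have habs : |-l| = l := by rw [abs_neg, abs_of_pos hl]
  have ha : l ^ (2 * H) * (2 * l * Real.exp (-2 * l) * J) / 2
      = l ^ (2 * H + 1) * Real.exp (-2 * l) * J := by
    rw [Real.rpow_add_one hl.ne']; ring
  have hp : (l ^ (2 * H + 1) * Real.exp (-2 * l) * J) ^ (-(1 / 2) : ℝ)
      = l ^ (-(2 * H + 1) / 2) * Real.exp l * J ^ (-(1 / 2) : ℝ) := by
    rw [Real.mul_rpow (by positivity) hJ.le, Real.mul_rpow (by positivity) (by positivity),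
      ← Real.rpow_mul hl.le, ← Real.exp_mul]
    congr 3 <;> ring
  have hi : (l ^ (2 * H + 1) * Real.exp (-2 * l) * J)⁻¹
      = l ^ (-2 * H - 1) * Real.exp (2 * l) * J⁻¹ := by
    rw [mul_inv, mul_inv, ← Real.rpow_neg hl.le, ← Real.exp_neg]
    congr 3 <;> ring
  have e1 : l ^ (2 * H) * l ^ (-(2 * H + 1) / 2) = l ^ ((2 * H - 1) / 2) := by
    rw [← Real.rpow_add hl]; congr 1; ring
  have e2 : l ^ (2 * H) * l ^ (-2 * H - 1) = l⁻¹ := by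
    rw [← Real.rpow_add hl, ← Real.rpow_neg_one]; congr 1; ring
  have e3 : Real.exp (-l) * Real.exp l = 1 := by rw [← Real.exp_add]; simp
  have e4 : Real.exp (-l) * Real.exp (2 * l) = Real.exp l := by
    rw [← Real.exp_add]; congr 1; ring
  have hvec : explosiveMap (l ^ (2 * H) * (2 * l * Real.exp (-2 * l) * J),
      l ^ (2 * H) * (Real.exp (-l) * N))
      = ![l ^ (-(2 * H + 1) / 2) * Real.exp l * J ^ (-(1 / 2) : ℝ),
        l ^ (-2 * H - 1) * Real.exp (2 * l) * J⁻¹,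
        l ^ ((2 * H - 1) / 2) * (N * J ^ (-(1 / 2) : ℝ)),
        l⁻¹ * Real.exp l * (N * J⁻¹)] := by
    simp only [explosiveMap, ha, hp, hi]
    congr 1
    congr 1
    congr 1
    · linear_combination (Real.exp (-l) * Real.exp l * N * J ^ (-(1 / 2) : ℝ)) * e1
        + (l ^ ((2 * H - 1) / 2) * N * J ^ (-(1 / 2) : ℝ)) * e3
    congr 1
    linear_combination (Real.exp (-l) * Real.exp (2 * l) * N * J⁻¹) * e2
        + (l⁻¹ * N * J⁻¹) * e4
  rw [hvec]
  ext i
  simp only [explosiveScaling, Matrix.mulVec_diagonal, habs, tau, Theta, ← hJdef, ← hN]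
  fin_cases i <;> rfl

theorem explosiveConstants_mulVec {G y z : ℝ} (H : ℝ) (hG : G = Real.Gamma (2 * H + 1))
    (hG0 : 0 < G) (hz : z ≠ 0) :
    explosiveMap ((√(G / 2) * z) ^ 2, √(G / 2) * z * (√(G / 2) * y))
      = (explosiveConstants H).mulVec ![|z|⁻¹, (z ^ 2)⁻¹, y * sgn z, y / z] := by
  have hs : √(G / 2) ^ 2 = G / 2 := Real.sq_sqrt (by positivity)
  have h1 : (√(G / 2) * z) ^ 2 / 2 = (√G / 2 * |z|) ^ 2 := by
    rw [mul_pow, hs, mul_pow, div_pow, Real.sq_sqrt hG0.le, sq_abs]; ring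
  have hz' : 0 < |z| := abs_pos.2 hz
  have hG' : 0 < √G := Real.sqrt_pos.2 hG0
  have hGG : √G * √G = G := Real.mul_self_sqrt hG0.le
  have h2 : ((√(G / 2) * z) ^ 2 / 2) ^ (-(1 / 2) : ℝ) = 2 / √G * |z|⁻¹ := by
    rw [h1, Real.rpow_neg (by positivity), ← Real.sqrt_eq_rpow, Real.sqrt_sq (by positivity)]
    field_simp
  have h3 : ((√(G / 2) * z) ^ 2 / 2)⁻¹ = 4 / G * (z ^ 2)⁻¹ := by
    rw [mul_pow, hs]; field_simp; norm_num
  have h4 : √(G / 2) * z * (√(G / 2) * y) = G / 2 * (z * y) := by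
    linear_combination (z * y) * hs
  -- The sign in the third limit coordinate arises here, from `z` divided by `|z|`.
  have hsgn : z = |z| * sgn z := by
    unfold sgn
    split_ifs with h
    · rw [abs_of_nonneg h, mul_one]
    · rw [abs_of_neg (not_le.1 h)]; ring
  have h5 : G / 2 * (z * y) * (2 / √G * |z|⁻¹) = √G * (y * sgn z) := by
    nth_rw 1 [hsgn, ← hGG]
    field_simp
  have h6 : G / 2 * (z * y) * (4 / G * (z ^ 2)⁻¹) = 2 * (y / z) := by
    field_simp; ring
  have hvec : explosiveMap ((√(G / 2) * z) ^ 2, √(G / 2) * z * (√(G / 2) * y))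
      = ![2 / √G * |z|⁻¹, 4 / G * (z ^ 2)⁻¹, √G * (y * sgn z), 2 * (y / z)] := by
    simp only [explosiveMap, h2, h3, h4, h5, h6]
  rw [hvec]
  ext i
  simp only [explosiveConstants, Matrix.mulVec_diagonal, ← hG]
  fin_cases i <;> rfl

variable {Ω : Type*} [MeasurableSpace Ω] {P : Measure Ω} {H : ℝ} {B : ℝ → Ω → ℝ}

namespace IsFractionalBrownianMotion

theorem aemeasurable (hB : IsFractionalBrownianMotion H B P) (t : ℝ) : AEMeasurable (B t) P :=
  hB.isGaussianProcess.aemeasurable t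

theorem aemeasurable_fOUPath (hB : IsFractionalBrownianMotion H B P) (hH : 0 < H) (γ : ℝ) {t : ℝ}
    (ht : 0 ≤ t) : AEMeasurable (fun ω => fOUPath γ (fun s => B s ω) t) P := by
  have h : AEMeasurable (fun ω => ∫ s in (0 : ℝ)..t, Real.exp (γ * s) * B s ω) P := by
    refine aemeasurable_intervalIntegral_of_continuous ht
      (fun s _ => (hB.aemeasurable s).const_mul _) ?_
    filter_upwards [hB.ae_continuous hH] with ω hω
    fun_prop
  exact (hB.aemeasurable t).sub (h.const_mul _)

theorem aemeasurable_fOU (hB : IsFractionalBrownianMotion H B P) (hH : 0 < H) (γ : ℝ) {t : ℝ}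
    (ht : 0 ≤ t) : AEMeasurable (fun ω => fOU γ (fun s => B s ω) t) P := by
  refine (hB.aemeasurable_fOUPath hH γ ht).congr ?_
  filter_upwards [hB.ae_continuous hH, hB.ae_apply_zero hH] with ω hω h0
  exact (fOU_eq hω h0 γ ht).symm

theorem aemeasurable_fOUEnergy (hB : IsFractionalBrownianMotion H B P) (hH : 0 < H) (γ : ℝ) :
    AEMeasurable (fun ω => fOUEnergy γ (fun s => B s ω)) P := by
  have h : AEMeasurable (fun ω => ∫ t in (0 : ℝ)..1, fOUPath γ (fun s => B s ω) t ^ 2) P := by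
    refine aemeasurable_intervalIntegral_of_continuous zero_le_one
      (fun t ht => (hB.aemeasurable_fOUPath hH γ ht).pow_const 2) ?_
    filter_upwards [hB.ae_continuous hH] with ω hω
    exact (continuous_fOUPath hω γ).pow 2
  refine h.congr ?_
  filter_upwards [hB.ae_continuous hH, hB.ae_apply_zero hH] with ω hω h0
  exact (fOUEnergy_eq hω h0 γ).symm

theorem aemeasurable_laplaceAt_one (hB : IsFractionalBrownianMotion H B P) (hH : 0 < H) (l : ℝ) :
    AEMeasurable (fun ω => laplaceAt l (fun s => B s ω) 1) P := by
  refine AEMeasurable.const_mul (aemeasurable_intervalIntegral_of_continuous zero_le_one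
      (fun s _ => (hB.aemeasurable s).const_mul _) ?_) _
  filter_upwards [hB.ae_continuous hH] with ω hω
  fun_prop

theorem aemeasurable_endpointLaplace (hB : IsFractionalBrownianMotion H B P) (hH : 0 < H)
    (l : ℝ) : AEMeasurable (fun ω => endpointLaplace l (fun s => B s ω)) P := by
  refine AEMeasurable.const_mul (aemeasurable_intervalIntegral_of_continuous zero_le_one
      (fun s _ => ((hB.aemeasurable 1).sub (hB.aemeasurable s)).const_mul _) ?_) _
  filter_upwards [hB.ae_continuous hH] with ω hω
  simp only [Pi.sub_apply]
  fun_prop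

theorem aemeasurable_explosiveScaling_mulVec_tau (hB : IsFractionalBrownianMotion H B P)
    (hH : 0 < H) (γ : ℝ) :
    AEMeasurable (fun ω => (explosiveScaling H γ).mulVec (tau γ fun t => B t ω)) P := by
  have h1 := hB.aemeasurable_fOU hH γ zero_le_one
  have h2 := hB.aemeasurable_fOUEnergy hH γ
  rw [aemeasurable_pi_iff]
  intro i
  simp only [explosiveScaling, Matrix.mulVec_diagonal]
  refine AEMeasurable.const_mul ?_ _
  fin_cases i <;> simp only [tau, Theta] <;> dsimp <;> fun_prop

theorem ae_fOUEnergy_pos (hB : IsFractionalBrownianMotion H B P) (hH : 0 < H) :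
    ∀ᵐ ω ∂P, ∀ γ : ℝ, 0 < fOUEnergy γ (fun s => B s ω) := by
  filter_upwards [hB.ae_continuous hH, hB.ae_apply_zero hH, hB.ae_apply_one_ne_zero hH]
    with ω hω h0 h1 γ
  exact fOUEnergy_pos hω h0 h1 γ

variable {Ω' : Type*} [MeasurableSpace Ω'] {P' : Measure Ω'} {Y Z : Ω' → ℝ}

theorem tendstoInDistribution_laplace [IsProbabilityMeasure P] [IsProbabilityMeasure P']
    (hB : IsFractionalBrownianMotion H B P) (hH0 : 0 < H) (hH1 : H < 1)
    (hYZ : HasLaw (fun ω => (Y ω, Z ω)) ((gaussianReal 0 1).prod (gaussianReal 0 1)) P')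
    {l : ℕ → ℝ} (hl : Tendsto l atTop atTop) :
    TendstoInDistribution (fun n ω => (l n ^ H * laplaceAt (l n) (fun t => B t ω) 1,
        l n ^ H * endpointLaplace (l n) fun t => B t ω)) atTop
      (fun ω => (√(Real.Gamma (2 * H + 1) / 2) * Z ω, √(Real.Gamma (2 * H + 1) / 2) * Y ω))
      (fun _ => P) P' := by
  have hY : AEMeasurable Y P' := measurable_fst.comp_aemeasurable hYZ.aemeasurable
  have hZ : AEMeasurable Z P' := measurable_snd.comp_aemeasurable hYZ.aemeasurable
  refine tendstoInDistribution_prodMk_of_charFun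
    (fun n => (hB.aemeasurable_laplaceAt_one hH0 _).const_mul _)
    (fun n => (hB.aemeasurable_endpointLaplace hH0 _).const_mul _)
    (hZ.const_mul _) (hY.const_mul _) fun a c => ?_
  have h := (hB.tendsto_integral_exp_combination hH0 hH1 a c).comp hl
  have hs : √(Real.Gamma (2 * H + 1) / 2) ^ 2 = Real.Gamma (2 * H + 1) / 2 :=
    Real.sq_sqrt (div_nonneg (Real.Gamma_pos_of_pos (by linarith)).le zero_le_two)
  have e := integral_exp_gaussian_combination hYZ (a * √(Real.Gamma (2 * H + 1) / 2))
    (c * √(Real.Gamma (2 * H + 1) / 2))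
  rw [mul_pow, mul_pow, hs, ← add_mul] at e
  simp only [mul_assoc] at e
  rw [e]
  exact h

/-- The pair of functionals is mapped by `(v, w) ↦ (v^2, v w)`; Slutsky's lemma replaces the result
by the true scaled energy and numerator, and `explosiveMap` is applied last. -/
theorem tendstoInDistribution_explosive_seq [IsProbabilityMeasure P] [IsProbabilityMeasure P']
    (hB : IsFractionalBrownianMotion H B P) (hH0 : 0 < H) (hH1 : H < 1)
    (hYZ : HasLaw (fun ω => (Y ω, Z ω)) ((gaussianReal 0 1).prod (gaussianReal 0 1)) P')
    {l : ℕ → ℝ} (hl0 : ∀ n, 0 < l n) (hl : Tendsto l atTop atTop) :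
    TendstoInDistribution
      (fun n ω => (explosiveScaling H (-l n)).mulVec (tau (-l n) fun t => B t ω)) atTop
      (fun ω => (explosiveConstants H).mulVec
        ![|Z ω|⁻¹, (Z ω ^ 2)⁻¹, Y ω * sgn (Z ω), Y ω / Z ω])
      (fun _ => P) P' := by
  have hG : 0 < Real.Gamma (2 * H + 1) := Real.Gamma_pos_of_pos (by linarith)
  have hs : 0 < √(Real.Gamma (2 * H + 1) / 2) := Real.sqrt_pos.2 (half_pos hG)
  have hZ0 : ∀ᵐ ω ∂P', Z ω ≠ 0 := by
    have hn := nullSingletonClass_gaussianReal (μ := 0) (v := 1) one_ne_zero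
    have h0 : P'.map (fun ω => (Y ω, Z ω)) (Set.univ ×ˢ {0}) = 0 := by
      rw [hYZ.map_eq, Measure.prod_prod, measure_singleton, mul_zero]
    rw [Measure.map_apply_of_aemeasurable hYZ.aemeasurable
      (MeasurableSet.univ.prod (measurableSet_singleton 0))] at h0
    exact measure_mono_null (fun ω hω =>
      show (Y ω, Z ω) ∈ Set.univ ×ˢ {(0 : ℝ)} from ⟨trivial, not_not.1 hω⟩) h0
  have h1 := (hB.tendstoInDistribution_laplace hH0 hH1 hYZ hl).continuous_comp
    (g := fun q : ℝ × ℝ => (q.1 ^ 2, q.1 * q.2)) (by fun_prop)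
  have hm : ∀ n, AEMeasurable (fun ω =>
      (l n ^ (2 * H) * (2 * l n * Real.exp (-2 * l n) * fOUEnergy (-l n) fun t => B t ω),
        l n ^ (2 * H) * (Real.exp (-l n) * (fOU (-l n) (fun t => B t ω) 1 ^ 2 / 2
          + -l n * fOUEnergy (-l n) fun t => B t ω)))) P := fun n => by
    have h1 := hB.aemeasurable_fOU hH0 (-l n) zero_le_one
    have h2 := hB.aemeasurable_fOUEnergy hH0 (-l n)
    fun_prop
  -- The pathwise error bounds give almost sure convergence of the difference to 0, hence
  -- convergence in measure.
  have h2 := tendstoInDistribution_of_tendstoInMeasure_sub _ _ h1 (by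
    refine tendstoInMeasure_of_tendsto_ae
      (fun n => ((hm n).sub (h1.forall_aemeasurable n)).aestronglyMeasurable) ?_
    filter_upwards [hB.ae_continuous hH0, hB.ae_apply_zero hH0] with ω hω h0
    exact ((tendsto_scaled_fOUEnergy_sub hω h0 H).comp hl).prodMk_nhds
      ((tendsto_scaled_numerator_sub hω h0 H).comp hl)) hm
  have h3 := tendstoInDistribution_comp_of_continuousOn
    (isOpen_lt continuous_const continuous_fst) continuousOn_explosiveMap
    measurable_explosiveMap (by
      filter_upwards [hZ0] with ω hω
      change 0 < (√(Real.Gamma (2 * H + 1) / 2) * Z ω) ^ 2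
      positivity) h2
  refine h3.congr (fun n => ?_) ?_
  · filter_upwards [hB.ae_fOUEnergy_pos hH0] with ω hω
    exact (explosiveScaling_mulVec_tau (hl0 n) (hω _)).symm
  · filter_upwards [hZ0] with ω hω
    exact explosiveConstants_mulVec H rfl hG hω

end IsFractionalBrownianMotion

end Explosive

theorem theorem3p2 {Ω Ω' : Type*} [MeasurableSpace Ω] [MeasurableSpace Ω']
    (P : Measure Ω) [IsProbabilityMeasure P] (P' : Measure Ω') [IsProbabilityMeasure P']
    (H : ℝ) (hH0 : 0 < H) (hH1 : H < 1)
    (B : ℝ → Ω → ℝ) (hB : IsFractionalBrownianMotion H B P)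
    (Y Z : Ω' → ℝ)
    (hYZ : HasLaw (fun ω => (Y ω, Z ω)) ((gaussianReal 0 1).prod (gaussianReal 0 1)) P') :
    (∀ᵐ ω ∂P, ∀ γ : ℝ,
      (∀ t : ℝ, 0 ≤ t → RSIntegrable (fun s => Real.exp (-γ * (t - s))) (fun s => B s ω) 0 t) ∧
      0 < fOUEnergy γ (fun s => B s ω)) ∧
    TendstoInDistribution
      (fun (γ : ℝ) (ω : Ω) => (explosiveScaling H γ).mulVec (tau γ (fun t => B t ω)))
      atBot
      (fun ω : Ω' => (explosiveConstants H).mulVec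
        ![|Z ω|⁻¹, (Z ω ^ 2)⁻¹, Y ω * sgn (Z ω), Y ω / Z ω])
      (fun _ => P) P' ∧
    HasLaw (fun ω => Y ω / Z ω) (cauchyMeasure 0 1) P' := by
  refine ⟨?_, ?_, ?_⟩
  · filter_upwards [hB.ae_continuous hH0, hB.ae_apply_zero hH0, hB.ae_fOUEnergy_pos hH0]
      with ω hω h0 hpos γ
    exact ⟨fun t ht => ⟨_, hasRSIntegral_exp hω h0 γ ht⟩, hpos γ⟩
  -- Measurability of the limit does not depend on the sequence, so it is read off from `l n = n +
  -- 1`.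
  · have hlim := (hB.tendstoInDistribution_explosive_seq hH0 hH1 hYZ
      (l := fun n : ℕ => (n : ℝ) + 1) (fun n => by positivity)
      (tendsto_natCast_atTop_atTop.atTop_add tendsto_const_nhds)).aemeasurable_limit
    refine ⟨hB.aemeasurable_explosiveScaling_mulVec_tau hH0, hlim, ?_⟩
    -- The filter `atBot` is countably generated, so sequences suffice; a shift by `N` makes every
    -- term negative.
    refine tendsto_of_seq_tendsto fun u hu => ?_
    obtain ⟨N, hN⟩ := eventually_atTop.1 (hu.eventually_lt_atBot 0)
    have hseq := hB.tendstoInDistribution_explosive_seq hH0 hH1 hYZ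
      (l := fun n => -u (n + N)) (fun n => neg_pos.2 (hN _ (by omega)))
      (tendsto_neg_atBot_atTop.comp ((tendsto_add_atTop_iff_nat N).2 hu))
    refine (tendsto_add_atTop_iff_nat N).1 ?_
    have := hseq.tendsto
    simp only [neg_neg] at this
    exact this
  · have hm : Measurable fun q : ℝ × ℝ => q.1 / q.2 := by fun_prop
    refine ⟨hm.comp_aemeasurable hYZ.aemeasurable, ?_⟩
    rw [← map_div_gaussianReal_prod, ← hYZ.map_eq,
      AEMeasurable.map_map_of_aemeasurable hm.aemeasurable hYZ.aemeasurable]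
    rfl
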